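/- Let $(R,\mathfrak m)$ be a commutative local artinian ring whose residue field $k=R/\mathfrak m$ is infinite, and let $A$ be a not necessarily commutative unital $R$-algebra, that is, a ring $A$ with a ring homomorphism $\varphi\colon R\to A$ (not necessarily injective) whose image lies in the centre of $A$. As usual we write $R$ and $\mathfrak m$ also for their images in $A$. An algebra over a commutative ring $S$ is called futile over $S$ if it has only finitely many $S$-subalgebras, and a module is called uniserial if its submodules are linearly ordered by inclusion. Then the following are equivalent. (i) $A$ is a futile $R$-algebra. (ii) $A$ is commutative and, writing $\mathfrak n=\sqrt{0_A}$ for the set of nilpotent elements of $A$, $T=R+\mathfrak n$ (an $R$-subalgebra of $A$, of which $\mathfrak n$ is an ideal) and $r_T=\dim_k\sqrt{0_{T/\mathfrak mT}}$ for the dimension of the ideal of nilpotent elements of $T/\mathfrak mT$: - $A/\mathfrak mA$ and $T/\mathfrak mT$ are futile $k$-algebras; - the submodule $\mathfrak m(A/R)$ of the $R$-module $A/R$ is uniserial; - if $r_T=2$, then $\mathfrak n^4+\mathfrak n^2\mathfrak m+\mathfrak m=\mathfrak mT$, where $\mathfrak n^4$ and $\mathfrak n^2$ are powers of the ideal $\mathfrak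 n$ of $T$, $\mathfrak n^2\mathfrak m$ is the set of finite sums of products $xy$ with $x\in\mathfrak n^2$, $y\in\mathfrak m$, the last summand on the left is the image of $\mathfrak m$ itself, and $\mathfrak mT$ is the ideal of $T$ generated by $\mathfrak m$. -/

import Mathlib

/-- An algebra is futile over `R` if it has only finitely many `R`-subalgebras. -/
def IsFutile (R A : Type*) [CommRing R] [Ring A] [Algebra R A] : Prop :=
  Finite (Subalgebra R A)

/-- A module is uniserial if its submodules are linearly ordered by inclusion. -/
def IsUniserial (R M : Type*) [Ring R] [AddCommGroup M] [Module R M] : Prop :=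
  ∀ N P : Submodule R M, N ≤ P ∨ P ≤ N

/-- The `R`-module `A / R`, the quotient of `A` by the image of the structure map `R → A`. -/
abbrev ModBase (R A : Type*) [CommRing R] [Ring A] [Algebra R A] : Type _ :=
  A ⧸ LinearMap.range (Algebra.linearMap R A)

/-- For commutative `A`, the subalgebra `R + √0_A`: sums of an element of the image of `R`
and a nilpotent element of `A`. -/
def basePlusNil (R A : Type*) [CommRing R] [CommRing A] [Algebra R A] : Subalgebra R A where
  carrier := {a | ∃ r : R, ∃ x : A, IsNilpotent x ∧ a = algebraMap R A r + x}
  mul_mem' := by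
    rintro _ _ ⟨r, x, hx, rfl⟩ ⟨s, y, hy, rfl⟩
    refine ⟨r * s, algebraMap R A r * y + x * (algebraMap R A s + y), ?_, ?_⟩
    · exact (Commute.all _ _).isNilpotent_add ((Commute.all _ _).isNilpotent_mul_left hy)
        ((Commute.all _ _).isNilpotent_mul_right hx)
    · rw [map_mul]; ring
  add_mem' := by
    rintro _ _ ⟨r, x, hx, rfl⟩ ⟨s, y, hy, rfl⟩
    exact ⟨r + s, x + y, (Commute.all _ _).isNilpotent_add hx hy, by rw [map_add]; ring⟩
  algebraMap_mem' r := ⟨r, 0, IsNilpotent.zero, by simp⟩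

/-- The set `√0_A`, as an ideal of `T = R + √0_A`. -/
def nilIdeal (R A : Type*) [CommRing R] [CommRing A] [Algebra R A] :
    Ideal (basePlusNil R A) :=
  (nilradical A).comap (algebraMap (basePlusNil R A) A)

/-- The quotient `B / 𝔪B`, where `𝔪` is the maximal ideal of `R`; it is an algebra over
`R / 𝔪`. -/
abbrev SpecialFibre (R B : Type*) [CommRing R] [IsLocalRing R] [CommRing B] [Algebra R B] :
    Type _ :=
  B ⧸ (IsLocalRing.maximalIdeal R).map (algebraMap R B)

/-- The dimension over `k = R / 𝔪` of the ideal of nilpotent elements of `B / 𝔪B`. -/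
noncomputable def fibreNilRank (R B : Type*) [CommRing R] [IsLocalRing R] [CommRing B]
    [Algebra R B] : Cardinal :=
  Module.rank (R ⧸ IsLocalRing.maximalIdeal R) (nilradical (SpecialFibre R B))

/-- The `R`-submodule `I ^ 4 + I ^ 2 𝔪 + 𝔪` of `B`, for an ideal `I` of `B`. The last term is the
image of `𝔪` itself, not the ideal of `B` that it generates. -/
def quarticSum (R : Type*) {B : Type*} [CommRing R] [IsLocalRing R] [CommRing B] [Algebra R B]
    (I : Ideal B) : Submodule R B :=
  (I ^ 4).restrictScalars R
    + IsLocalRing.maximalIdeal R • (I ^ 2).restrictScalars R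
    + Submodule.map (Algebra.linearMap R B) (IsLocalRing.maximalIdeal R)

/-! ### Nilpotent Nakayama and the pigeonhole principle over the residue field. -/

open IsLocalRing

/-! Necessity rests on one pigeonhole. In a family of subalgebras indexed by `t` in `R`, two members
coincide at parameters differing by a unit; if the member at `t` contains `v + t w`, one of them
contains `w`. The family `R[a + t b]` makes `A` commutative and monogenic. The family `R[y² + t y³]`
kills cubes of nilpotents in the fibre, so `T` is spanned modulo `𝔪T` by `1, y, y²` with `y`
nilpotent. Families `R + R(v + t w) + Z` give both the quartic condition (`quarticSum_eq`) and the
uniserial one: `𝔪^i A` has at most one-dimensional image modulo `R + 𝔪^(i+1) A`.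

For sufficiency, the subalgebras `B + 𝔪^(j+1) A` are counted by induction on `j`, from the special
fibre until the power of `𝔪` vanishes. Uniseriality makes each layer a line modulo `R`, so a
subalgebra not containing the layer meets `𝔪A` only in `𝔪` plus the next power. Two such subalgebras
with the same image one level up must be equal: otherwise their difference can be moved to a
nilpotent element of `T`, where it contradicts the quartic condition
(`false_of_exists_isNilpotent`). -/

theorem IsArtinianRing.isNilpotent_maximalIdeal (R : Type*) [CommRing R] [IsLocalRing R]
    [IsArtinianRing R] : IsNilpotent (maximalIdeal R) := by
  have h := IsArtinianRing.isNilpotent_jacobson_bot (R := R)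
  rwa [jacobson_eq_maximalIdeal ⊥ bot_ne_top] at h

/-- Nakayama's lemma for a nilpotent ideal, without finiteness hypotheses on the module. -/
theorem Submodule.le_of_le_sup_smul_of_isNilpotent {R M : Type*} [CommRing R] [AddCommGroup M]
    [Module R M] {I : Ideal R} (hI : IsNilpotent I) {P S : Submodule R M}
    (h : P ≤ S ⊔ I • P) : P ≤ S := by
  obtain ⟨n, hn⟩ := hI
  have key : ∀ i : ℕ, P ≤ S ⊔ I ^ i • P := by
    intro i
    induction i with
    | zero => simp
    | succ i ih =>
      refine ih.trans (sup_le le_sup_left ?_)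
      calc I ^ i • P ≤ I ^ i • (S ⊔ I • P) := Submodule.smul_mono le_rfl h
        _ = I ^ i • S ⊔ I ^ (i + 1) • P := by
            rw [Submodule.smul_sup, pow_succ, Submodule.mul_smul]
        _ ≤ S ⊔ I ^ (i + 1) • P := sup_le_sup_right Submodule.smul_le_right _
  simpa [hn] using key n

/-- Pigeonhole on representatives of the residue classes: in a local ring, representatives of
distinct classes differ by a unit. -/
theorem IsLocalRing.exists_isUnit_sub_and_eq {R α : Type*} [CommRing R] [IsLocalRing R]
    [Infinite (R ⧸ maximalIdeal R)] [Finite α] (f : R → α) :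
    ∃ r s : R, IsUnit (r - s) ∧ f r = f s := by
  obtain ⟨q, q', hne, he⟩ :=
    Finite.exists_ne_map_eq_of_infinite (fun q : R ⧸ maximalIdeal R => f (Quotient.out q))
  refine ⟨_, _, ?_, he⟩
  by_contra hu
  apply hne
  have := (Ideal.Quotient.mk_eq_mk_iff_sub_mem _ _).2 ((mem_maximalIdeal _).2 hu)
  rwa [Ideal.Quotient.mk_out, Ideal.Quotient.mk_out] at this

theorem Submodule.mem_of_add_smul_mem {R M : Type*} [CommRing R] [AddCommGroup M] [Module R M]
    {S : Submodule R M} {v w : M} {t t' : R} (h : IsUnit (t - t')) (h1 : v + t • w ∈ S)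
    (h2 : v + t' • w ∈ S) : w ∈ S := by
  have := sub_mem h1 h2
  rwa [add_sub_add_left_eq_sub, ← sub_smul, S.smul_mem_iff_of_isUnit h] at this

/-! ### Futile algebras are commutative and monogenic. -/

section Futile

variable {R A B : Type*} [CommRing R] [Ring A] [Algebra R A] [Ring B] [Algebra R B]

theorem IsFutile.of_surjective (h : IsFutile R A) (f : A →ₐ[R] B) (hf : Function.Surjective f) :
    IsFutile R B := by
  have : Finite (Subalgebra R A) := h
  refine Finite.of_injective (fun C : Subalgebra R B => C.comap f) fun C D hCD => ?_
  ext b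
  obtain ⟨a, rfl⟩ := hf b
  simpa using SetLike.ext_iff.1 hCD a

theorem IsFutile.subalgebra (h : IsFutile R A) (S : Subalgebra R A) : IsFutile R S := by
  have : Finite (Subalgebra R A) := h
  exact Finite.of_injective (fun C : Subalgebra R S => C.map S.val)
    (Subalgebra.map_injective Subtype.val_injective)

theorem isFutile_iff_of_surjective_algebraMap {k : Type*} [CommRing k] [Algebra R k]
    [Algebra k A] [IsScalarTower R k A] (hk : Function.Surjective (algebraMap R k)) :
    IsFutile k A ↔ IsFutile R A := by
  constructor
  · intro (h : Finite (Subalgebra k A))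
    refine Finite.of_injective (fun C : Subalgebra R A =>
      ({ C with
        algebraMap_mem' := fun x => by
          obtain ⟨r, rfl⟩ := hk x
          rw [← IsScalarTower.algebraMap_apply]
          exact C.algebraMap_mem r } : Subalgebra k A)) fun C D hCD => ?_
    ext b
    exact SetLike.ext_iff.1 hCD b
  · intro (h : Finite (Subalgebra R A))
    exact Finite.of_injective (fun C : Subalgebra k A => C.restrictScalars R)
      (Subalgebra.restrictScalars_injective R)

variable [IsLocalRing R] [Infinite (R ⧸ maximalIdeal R)]

/-- Two of the algebras `R[a + r b]` coincide at parameters differing by a unit; the common algebra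
contains `b`, hence `a`. -/
theorem IsFutile.exists_mem_adjoin_singleton (h : IsFutile R A) (a b : A) :
    ∃ c, a ∈ Algebra.adjoin R {c} ∧ b ∈ Algebra.adjoin R {c} := by
  have : Finite (Subalgebra R A) := h
  obtain ⟨r, s, hu, he⟩ := exists_isUnit_sub_and_eq
    (fun r : R => Algebra.adjoin R {a + r • b})
  replace he : Algebra.adjoin R {a + r • b} = Algebra.adjoin R {a + s • b} := he
  have h1 : a + r • b ∈ Algebra.adjoin R {a + r • b} := Algebra.self_mem_adjoin_singleton R _
  have h2 : a + s • b ∈ Algebra.adjoin R {a + r • b} := by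
    rw [he]; exact Algebra.self_mem_adjoin_singleton R _
  have h3 : b ∈ Algebra.adjoin R {a + r • b} :=
    Submodule.mem_of_add_smul_mem
      (S := (Algebra.adjoin R {a + r • b}).toSubmodule) hu h1 h2
  refine ⟨_, ?_, h3⟩
  simpa using sub_mem h1 (Subalgebra.smul_mem _ h3 r)

theorem IsFutile.mul_comm (h : IsFutile R A) (a b : A) : a * b = b * a := by
  obtain ⟨c, ha, hb⟩ := h.exists_mem_adjoin_singleton a b
  exact Algebra.commute_of_mem_adjoin_singleton_of_commute hb
    (Algebra.commute_of_mem_adjoin_self ha).symm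

/-- A maximal algebra among the `R[c]` absorbs every `a`, since `c` and `a` lie in a common `R[d]`.
-/
theorem IsFutile.exists_adjoin_singleton_eq_top (h : IsFutile R A) :
    ∃ c : A, Algebra.adjoin R {c} = ⊤ := by
  have : Finite (Subalgebra R A) := h
  obtain ⟨_, ⟨c, rfl⟩, hc⟩ := (Set.toFinite
    (Set.range fun c : A => Algebra.adjoin R {c})).exists_maximal (Set.range_nonempty _)
  refine ⟨c, eq_top_iff.2 fun a _ => ?_⟩
  obtain ⟨d, h1, h2⟩ := h.exists_mem_adjoin_singleton c a
  exact hc ⟨d, rfl⟩ (Algebra.adjoin_le (Set.singleton_subset_iff.2 h1)) h2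

end Futile

/-- A futile algebra over an infinite field is finite. -/
theorem IsFutile.finite_of_field {k A : Type*} [Field k] [Infinite k] [CommRing A] [Algebra k A]
    (h : IsFutile k A) : Module.Finite k A := by
  have : Infinite (k ⧸ maximalIdeal k) := by
    rw [IsLocalRing.maximalIdeal_eq_bot]
    exact Infinite.of_injective _ (RingEquiv.quotientBot k).symm.injective
  have hfin : Finite (Subalgebra k A) := h
  obtain ⟨c, hc⟩ := h.exists_adjoin_singleton_eq_top
  obtain ⟨i, j, hne, hij⟩ := Finite.exists_ne_map_eq_of_infinite
    (fun i : ℕ => Algebra.adjoin k {c ^ (i + 1)})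
  wlog hlt : i < j generalizing i j
  · exact this j i hne.symm hij.symm (by omega)
  have hmem : c ^ (i + 1) ∈ Algebra.adjoin k {c ^ (j + 1)} := by
    have := Algebra.self_mem_adjoin_singleton k (c ^ (i + 1))
    rwa [show Algebra.adjoin k {c ^ (i + 1)} = Algebra.adjoin k {c ^ (j + 1)} from hij] at this
  rw [Algebra.adjoin_singleton_eq_range_aeval] at hmem
  obtain ⟨p, hp⟩ := hmem
  have halg : IsAlgebraic k c := by
    -- The expanded polynomial only has exponents divisible by `j + 1`, and `0 < i + 1 < j + 1`, so
    -- the coefficient of `X ^ (i + 1)` is `1`.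
    refine ⟨Polynomial.X ^ (i + 1) - Polynomial.expand k (j + 1) p, fun h0 => ?_, ?_⟩
    · have := congrArg (fun q => Polynomial.coeff q (i + 1)) h0
      simp only [Polynomial.coeff_sub, Polynomial.coeff_X_pow, if_true, Polynomial.coeff_zero,
        Polynomial.coeff_expand (Nat.succ_pos j)] at this
      rw [if_neg (fun hd => by have := Nat.le_of_dvd (Nat.succ_pos i) hd; omega)] at this
      simp at this
    · have hp' : Polynomial.aeval (c ^ (j + 1)) p = c ^ (i + 1) := hp
      simp [Polynomial.expand_aeval, hp']
  have := halg.isIntegral.fg_adjoin_singleton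
  rw [hc] at this
  exact ⟨this⟩

/-! ### Finiteness lifts from the special fibre. -/

section LocalArtinian

variable {R A : Type*} [CommRing R] [IsLocalRing R] [IsArtinianRing R] [CommRing A] [Algebra R A]

theorem finite_of_isFutile_specialFibre [Infinite (R ⧸ maximalIdeal R)]
    (h : IsFutile (R ⧸ maximalIdeal R) (SpecialFibre R A)) : Module.Finite R A := by
  let _ : Field (R ⧸ maximalIdeal R) := Ideal.Quotient.field _
  have h1 : Module.Finite (R ⧸ maximalIdeal R) (SpecialFibre R A) := IsFutile.finite_of_field h
  have h2 : Module.Finite R (SpecialFibre R A) := Module.Finite.trans (R ⧸ maximalIdeal R) _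
  obtain ⟨s, hs⟩ := h2.fg_top
  let f : A →ₗ[R] SpecialFibre R A :=
    (Ideal.Quotient.mkₐ R ((maximalIdeal R).map (algebraMap R A))).toLinearMap
  have hf : Function.Surjective f := Ideal.Quotient.mk_surjective
  choose g hg using hf
  refine Module.finite_def.2 ((Submodule.fg_def).2 ⟨g '' s, s.finite_toSet.image g, ?_⟩)
  refine top_le_iff.1 (Submodule.le_of_le_sup_smul_of_isNilpotent
    (IsArtinianRing.isNilpotent_maximalIdeal R) fun a _ => ?_)
  have hmap : (Submodule.span R (g '' s)).map f = ⊤ := by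
    rw [Submodule.map_span, ← Set.image_comp, (funext hg : f ∘ g = id), Set.image_id, hs]
  obtain ⟨b, hb, hab⟩ : f a ∈ (Submodule.span R (g '' s)).map f := hmap ▸ Submodule.mem_top
  refine Submodule.mem_sup.2 ⟨b, hb, a - b, ?_, by abel⟩
  rw [Ideal.smul_top_eq_map]
  exact (Ideal.Quotient.mk_eq_mk_iff_sub_mem _ _).1 hab.symm

end LocalArtinian

/-! ### The pigeonhole for subalgebras `R + R v + Z`. -/

/-- The subalgebra `R + R v + Z`, for a submodule `Z` closed under multiplication by itself and
by `v` and containing `v * v`. -/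
def Subalgebra.baseAddSpanAdd {R A : Type*} [CommRing R] [CommRing A] [Algebra R A]
    (Z : Submodule R A) (v : A) (hv : v * v ∈ Z) (hvZ : ∀ z ∈ Z, v * z ∈ Z)
    (hZ : ∀ z ∈ Z, ∀ z' ∈ Z, z * z' ∈ Z) : Subalgebra R A where
  carrier := {a | ∃ r s : R, ∃ z ∈ Z, a = algebraMap R A r + s • v + z}
  mul_mem' := by
    rintro _ _ ⟨r, s, z, hz, rfl⟩ ⟨r', s', z', hz', rfl⟩
    refine ⟨r * r', r * s' + r' * s, (s * s') • (v * v) + r • z' + r' • z + s • (v * z')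
      + s' • (v * z) + z * z', ?_, ?_⟩
    · exact add_mem (add_mem (add_mem (add_mem (add_mem (Z.smul_mem _ hv) (Z.smul_mem _ hz'))
        (Z.smul_mem _ hz)) (Z.smul_mem _ (hvZ _ hz'))) (Z.smul_mem _ (hvZ _ hz))) (hZ _ hz _ hz')
    · simp only [Algebra.smul_def, map_mul, map_add]; ring
  add_mem' := by
    rintro _ _ ⟨r, s, z, hz, rfl⟩ ⟨r', s', z', hz', rfl⟩
    exact ⟨r + r', s + s', z + z', add_mem hz hz', by rw [map_add, add_smul]; abel⟩
  algebraMap_mem' r := ⟨r, 0, 0, Z.zero_mem, by simp⟩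

/-- The form of the pigeonhole used for necessity: two of the subalgebras `R + R(v + t w) + Z`
coincide, so one contains `w`. It is used with `s` then shown to be a unit or a non-unit. -/
theorem IsFutile.exists_eq_algebraMap_add_smul_add {R A : Type*} [CommRing R] [IsLocalRing R]
    [Infinite (R ⧸ maximalIdeal R)] [CommRing A] [Algebra R A] (h : IsFutile R A)
    (Z : Submodule R A) (v w : A) (hv : ∀ t : R, (v + t • w) * (v + t • w) ∈ Z)
    (hvZ : ∀ t : R, ∀ z ∈ Z, (v + t • w) * z ∈ Z) (hZ : ∀ z ∈ Z, ∀ z' ∈ Z, z * z' ∈ Z) :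
    ∃ t r s : R, ∃ z ∈ Z, w = algebraMap R A r + s • (v + t • w) + z := by
  have : Finite (Subalgebra R A) := h
  let C (t : R) := Subalgebra.baseAddSpanAdd Z (v + t • w) (hv t) (hvZ t) hZ
  obtain ⟨t, t', hu, hC⟩ := exists_isUnit_sub_and_eq C
  have hself (t : R) : v + t • w ∈ C t := ⟨0, 1, 0, Z.zero_mem, by simp⟩
  refine ⟨t, ?_⟩
  change w ∈ C t
  have h2 : v + t' • w ∈ C t := hC ▸ hself t'
  exact Submodule.mem_of_add_smul_mem (S := (C t).toSubmodule) hu (hself t) h2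

theorem IsLocalRing.mem_maximalIdeal_of_isNilpotent_algebraMap {R A : Type*} [CommRing R]
    [IsLocalRing R] [CommRing A] [Algebra R A] [Nontrivial A] {r : R}
    (h : IsNilpotent (algebraMap R A r)) : r ∈ maximalIdeal R :=
  fun hu => (h.not_isUnit (hu.map (algebraMap R A)))

theorem IsNilpotent.eq_zero_of_mul_algebraMap_add_eq_zero {R A : Type*} [CommRing R]
    [CommRing A] [Algebra R A] {r : R} (hr : IsUnit r) {x a : A} (hx : IsNilpotent x)
    (h : a * (algebraMap R A r + x) = 0) : a = 0 :=
  (hx.isUnit_add_left_of_commute (hr.map (algebraMap R A)) (Commute.all _ _)).mul_left_eq_zero.1 h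

/-- A nilpotent element `y` with `y³ ∈ 𝔪 A` such that `1, y, y²` span `A` modulo `𝔪 A`. -/
structure IsNilpotentGenerator (R : Type*) {A : Type*} [CommRing R] [IsLocalRing R] [CommRing A]
    [Algebra R A] (y : A) : Prop where
  isNilpotent : IsNilpotent y
  pow_three_mem : y ^ 3 ∈ (maximalIdeal R).map (algebraMap R A)
  exists_sub_mem : ∀ z : A, ∃ a b c : R, z - (algebraMap R A a + b • y + c • y ^ 2) ∈
    (maximalIdeal R).map (algebraMap R A)

/-! ### Nilpotents in the special fibre. -/

section Cubic

variable {R A : Type*} [CommRing R] [IsLocalRing R] [CommRing A] [Algebra R A]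

/-- With `c = y² + t y³` and `y³ ∈ R[c]`, write `y³ = a + b c + w c²`. Nilpotency forces `a = 0`. As
`c²` is divisible by `y⁴`, the equation becomes `y²` times a unit equals zero when `b` is a unit,
and `y³` times a unit equals zero when `b` vanishes in `A`. -/
theorem IsFutile.pow_three_eq_zero [Infinite (R ⧸ maximalIdeal R)] (h : IsFutile R A)
    (hm : ∀ r ∈ maximalIdeal R, algebraMap R A r = 0) {y : A} (hy : IsNilpotent y) :
    y ^ 3 = 0 := by
  have hfin : Finite (Subalgebra R A) := h
  rcases subsingleton_or_nontrivial A with hA | hA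
  · exact Subsingleton.elim _ _
  obtain ⟨t, t', hu, hC⟩ := exists_isUnit_sub_and_eq
    (fun t : R => Algebra.adjoin R {y ^ 2 + t • y ^ 3})
  replace hC : Algebra.adjoin R {y ^ 2 + t • y ^ 3} = Algebra.adjoin R {y ^ 2 + t' • y ^ 3} := hC
  have h1 := Algebra.self_mem_adjoin_singleton R (y ^ 2 + t • y ^ 3)
  have h2 := Algebra.self_mem_adjoin_singleton R (y ^ 2 + t' • y ^ 3)
  rw [← hC] at h2
  have h3 : y ^ 3 ∈ Algebra.adjoin R {y ^ 2 + t • y ^ 3} :=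
    Submodule.mem_of_add_smul_mem
      (S := (Algebra.adjoin R {y ^ 2 + t • y ^ 3}).toSubmodule) hu h1 h2
  rw [Algebra.adjoin_singleton_eq_range_aeval] at h3
  obtain ⟨p, hp⟩ := h3
  replace hp : Polynomial.aeval (y ^ 2 + t • y ^ 3) p = y ^ 3 := hp
  rw [← p.divX_mul_X_add, ← p.divX.divX_mul_X_add] at hp
  simp only [map_add, map_mul, Polynomial.aeval_X, Polynomial.aeval_C] at hp
  generalize Polynomial.aeval (y ^ 2 + t • y ^ 3) p.divX.divX = w at hp
  generalize p.divX.coeff 0 = b at hp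
  have ha : algebraMap R A (p.coeff 0) = 0 := by
    apply hm
    apply mem_maximalIdeal_of_isNilpotent_algebraMap (A := A)
    have : algebraMap R A (p.coeff 0) = y * (y ^ 2 - (w * (y ^ 2 + t • y ^ 3) + algebraMap R A b) *
        (y + t • y ^ 2)) := by
      rw [eq_sub_of_add_eq' hp]
      simp only [Algebra.smul_def]; ring
    rw [this]
    exact (Commute.all _ _).isNilpotent_mul_right hy
  rw [ha, add_zero] at hp
  by_cases hb : IsUnit b
  · have : y ^ 2 = 0 := by
      refine IsNilpotent.eq_zero_of_mul_algebraMap_add_eq_zero hb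
        (x := y * (algebraMap R A (b * t) - 1 + y * w * (1 + algebraMap R A t * y) ^ 2))
        ((Commute.all _ _).isNilpotent_mul_right hy) ?_
      simp only [Algebra.smul_def] at hp
      rw [map_mul]
      linear_combination hp
    rw [pow_succ, this, zero_mul]
  · rw [hm b hb, add_zero] at hp
    refine IsNilpotent.eq_zero_of_mul_algebraMap_add_eq_zero (R := R) isUnit_one
      (x := y * (- w * (1 + algebraMap R A t * y) ^ 2))
      ((Commute.all _ _).isNilpotent_mul_right hy) ?_
    simp only [Algebra.smul_def] at hp
    rw [map_one]
    linear_combination -hp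

/-- If `T` is the sum of `R` and its nilradical and `T / 𝔪 T` is futile, then `T / 𝔪 T` has
a nilpotent generator. -/
theorem exists_isNilpotentGenerator [Infinite (R ⧸ maximalIdeal R)]
    (hA : ∀ a : A, ∃ r : R, ∃ x : A, IsNilpotent x ∧ a = algebraMap R A r + x)
    (h : IsFutile (R ⧸ maximalIdeal R) (SpecialFibre R A)) :
    ∃ y : A, IsNilpotentGenerator R y := by
  replace h : IsFutile R (SpecialFibre R A) :=
    (isFutile_iff_of_surjective_algebraMap Ideal.Quotient.mk_surjective).1 h
  obtain ⟨c, hc⟩ := h.exists_adjoin_singleton_eq_top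
  obtain ⟨c, rfl⟩ := Ideal.Quotient.mk_surjective c
  -- Translating the generator by a scalar leaves the generated algebra unchanged, so the generator
  -- may be taken nilpotent.
  obtain ⟨r, y, hy, rfl⟩ := hA c
  set mk := Ideal.Quotient.mk ((maximalIdeal R).map (algebraMap R A)) with hmk
  have hmk' (r : R) : algebraMap R (SpecialFibre R A) r = mk (algebraMap R A r) := rfl
  have hy3 : mk y ^ 3 = 0 := h.pow_three_eq_zero (fun r hr =>
    Ideal.Quotient.eq_zero_iff_mem.2 (Ideal.mem_map_of_mem _ hr)) (hy.map mk)
  refine ⟨y, hy, by rwa [← map_pow, Ideal.Quotient.eq_zero_iff_mem] at hy3, fun z => ?_⟩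
  have htop : Algebra.adjoin R {mk y} = ⊤ := by
    rw [eq_top_iff, ← hc]
    refine Algebra.adjoin_le (Set.singleton_subset_iff.2 ?_)
    rw [map_add, ← hmk']
    exact add_mem (Subalgebra.algebraMap_mem _ _) (Algebra.self_mem_adjoin_singleton R _)
  have hz : mk z ∈ Algebra.adjoin R {mk y} := htop ▸ Algebra.mem_top
  rw [Algebra.adjoin_singleton_eq_range_aeval] at hz
  obtain ⟨p, hp⟩ := hz
  replace hp : Polynomial.aeval (mk y) p = mk z := hp
  rw [← p.divX_mul_X_add, ← p.divX.divX_mul_X_add, ← p.divX.divX.divX_mul_X_add] at hp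
  simp only [map_add, map_mul, Polynomial.aeval_X, Polynomial.aeval_C] at hp
  refine ⟨p.coeff 0, p.divX.coeff 0, p.divX.divX.coeff 0, ?_⟩
  rw [← Ideal.Quotient.eq_zero_iff_mem, ← hmk]
  simp only [Algebra.smul_def, map_sub, map_add, map_mul, map_pow, ← hmk', ← hp]
  linear_combination (Polynomial.aeval (mk y) p.divX.divX.divX) * hy3

/-- The classes of `y` and `y²` span the nilradical of the fibre. If the class of `y²` is nonzero
they are independent: a relation with nonzero coefficient at `y` is `y` times a unit. -/
theorem IsNilpotentGenerator.fibreNilRank_eq_two_iff {y : A} (hg : IsNilpotentGenerator R y) :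
    fibreNilRank R A = 2 ↔ y ^ 2 ∉ (maximalIdeal R).map (algebraMap R A) := by
  obtain ⟨hy, -, hspan⟩ := hg
  let _ : Field (R ⧸ maximalIdeal R) := Ideal.Quotient.field _
  unfold fibreNilRank
  set mk := Ideal.Quotient.mk ((maximalIdeal R).map (algebraMap R A)) with hmk
  have hmk' (r : R) : algebraMap (R ⧸ maximalIdeal R) (SpecialFibre R A)
    (Ideal.Quotient.mk _ r) = mk (algebraMap R A r) := rfl
  have hspan' : ∀ z : SpecialFibre R A, ∃ a b c : R ⧸ maximalIdeal R,
      z = algebraMap _ _ a + b • mk y + c • mk (y ^ 2) := by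
    intro z
    obtain ⟨z, rfl⟩ := Ideal.Quotient.mk_surjective z
    obtain ⟨a, b, c, h⟩ := hspan z
    refine ⟨Ideal.Quotient.mk _ a, Ideal.Quotient.mk _ b, Ideal.Quotient.mk _ c, ?_⟩
    rw [← Ideal.Quotient.mk_eq_mk_iff_sub_mem] at h
    refine h.trans ?_
    simp only [Algebra.smul_def, hmk', map_add, map_mul, hmk]
  have hyn : IsNilpotent (mk y) := hy.map mk
  have hyn2 : IsNilpotent (mk (y ^ 2)) := (hy.pow_of_pos two_ne_zero).map mk
  rw [← Ideal.Quotient.eq_zero_iff_mem, ← hmk]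
  have hzero : ∀ z : nilradical (SpecialFibre R A), ∃ b c : R ⧸ maximalIdeal R,
      (z : SpecialFibre R A) = b • mk y + c • mk (y ^ 2) := by
    rintro ⟨z, hz⟩
    obtain ⟨a, b, c, h⟩ := hspan' z
    have hn : IsNilpotent (algebraMap (R ⧸ maximalIdeal R) (SpecialFibre R A) a) := by
      have : algebraMap (R ⧸ maximalIdeal R) (SpecialFibre R A) a
        = z - (b • mk y + c • mk (y ^ 2)) := by rw [h]; ring
      rw [this]
      exact (Commute.all _ _).isNilpotent_sub hz ((Commute.all _ _).isNilpotent_add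
        (hyn.smul _) (hyn2.smul _))
    have ha : algebraMap (R ⧸ maximalIdeal R) (SpecialFibre R A) a = 0 := by
      rcases subsingleton_or_nontrivial (SpecialFibre R A) with hs | hs
      · exact Subsingleton.elim _ _
      · by_cases ha : a = 0
        · rw [ha, map_zero]
        · exact absurd ((IsUnit.mk0 a ha).map (algebraMap (R ⧸ maximalIdeal R)
            (SpecialFibre R A))) hn.not_isUnit
    exact ⟨b, c, by rw [ha, zero_add] at h; exact h⟩
  constructor
  · intro hr h0
    have : Module.rank (R ⧸ maximalIdeal R) (nilradical (SpecialFibre R A)) ≤ 1 := by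
      refine rank_le_one_iff.2 ⟨⟨mk y, hyn⟩, fun z => ?_⟩
      obtain ⟨b, c, h⟩ := hzero z
      exact ⟨b, Subtype.ext (by rw [h, h0, smul_zero, add_zero]; rfl)⟩
    rw [hr] at this
    exact absurd this (by norm_num)
  · intro h0
    let v : Fin 2 → nilradical (SpecialFibre R A) := ![⟨mk y, hyn⟩, ⟨mk (y ^ 2), hyn2⟩]
    have hli : LinearIndependent (R ⧸ maximalIdeal R) v := by
      refine LinearIndependent.pair_iff.2 fun s t hst => ?_
      replace hst : s • mk y + t • mk (y ^ 2) = 0 := congrArg Subtype.val hst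
      have hs : s = 0 := by
        by_contra hs
        apply h0
        have : mk y = 0 := by
          refine IsNilpotent.eq_zero_of_mul_algebraMap_add_eq_zero (IsUnit.mk0 s hs)
            (hyn.smul t) ?_
          simp only [Algebra.smul_def, map_pow] at hst ⊢
          linear_combination hst
        rw [map_pow, this, zero_pow two_ne_zero]
      refine ⟨hs, ?_⟩
      by_contra ht
      rw [hs, zero_smul, zero_add] at hst
      exact h0 ((smul_eq_zero_iff_right ht).1 hst)
    have hsp : ⊤ ≤ Submodule.span (R ⧸ maximalIdeal R) (Set.range v) := by
      intro z _
      obtain ⟨b, c, h⟩ := hzero z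
      have : z = b • v 0 + c • v 1 := Subtype.ext h
      rw [this]
      exact add_mem (Submodule.smul_mem _ _ (Submodule.subset_span ⟨0, rfl⟩))
        (Submodule.smul_mem _ _ (Submodule.subset_span ⟨1, rfl⟩))
    rw [rank_eq_card_basis (Module.Basis.mk hli hsp)]
    simp

end Cubic

theorem Submodule.mul_mem_smul {R A : Type*} [CommRing R] [CommRing A] [Algebra R A]
    {J : Ideal R} {S S' : Submodule R A} {a z : A} (h : ∀ s ∈ S, a * s ∈ S') (hz : z ∈ J • S) :
    a * z ∈ J • S' := by
  refine Submodule.smul_induction_on hz (fun r hr s hs => ?_) fun x y hx hy => ?_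
  · rw [mul_smul_comm]
    exact Submodule.smul_mem_smul hr (h s hs)
  · rw [mul_add]; exact add_mem hx hy

theorem Submodule.mul_mem_smul_smul_top {R A : Type*} [CommRing R] [CommRing A] [Algebra R A]
    {I J : Ideal R} {z w : A} (hz : z ∈ I • (⊤ : Submodule R A))
    (hw : w ∈ J • (⊤ : Submodule R A)) : z * w ∈ J • I • (⊤ : Submodule R A) := by
  refine Submodule.mul_mem_smul (fun s _ => ?_) hw
  rw [mul_comm]
  exact Submodule.mul_mem_smul (fun _ _ => trivial) hz

/-! ### The quartic condition. -/

section

variable {R A : Type*} [CommRing R] [IsLocalRing R] [CommRing A] [Algebra R A]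

theorem IsLocalRing.mem_smul_top_iff {z : A} :
    z ∈ maximalIdeal R • (⊤ : Submodule R A) ↔ z ∈ (maximalIdeal R).map (algebraMap R A) := by
  rw [Ideal.smul_top_eq_map]; rfl

theorem IsLocalRing.smul_mem_map {r : R} (hr : r ∈ maximalIdeal R) (a : A) :
    r • a ∈ (maximalIdeal R).map (algebraMap R A) :=
  mem_smul_top_iff.1 (Submodule.smul_mem_smul hr trivial)

theorem IsLocalRing.isNilpotent_of_mem_map [IsArtinianRing R] {z : A}
    (hz : z ∈ (maximalIdeal R).map (algebraMap R A)) : IsNilpotent z := by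
  have : (maximalIdeal R).map (algebraMap R A) ≤ nilradical A := by
    refine Ideal.map_le_iff_le_comap.2 fun r hr => ?_
    obtain ⟨n, hn⟩ := IsArtinianRing.isNilpotent_maximalIdeal R
    have : IsNilpotent r := ⟨n, by
      have := Ideal.pow_mem_pow hr n
      rwa [hn, Ideal.zero_eq_bot, Ideal.mem_bot] at this⟩
    exact this.map (algebraMap R A)
  exact this hz

namespace IsNilpotentGenerator

variable {y : A}

theorem mem_maximalIdeal_of_add_mem (hg : IsNilpotentGenerator R y)
    (hy2 : y ^ 2 ∉ (maximalIdeal R).map (algebraMap R A)) {r s : R}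
    (h : algebraMap R A r + s • y ^ 2 ∈ (maximalIdeal R).map (algebraMap R A)) :
    r ∈ maximalIdeal R ∧ s ∈ maximalIdeal R := by
  have hr : r ∈ maximalIdeal R := by
    intro hr
    apply hy2
    have hu := ((hg.isNilpotent.pow_of_pos two_ne_zero).smul s).isUnit_add_left_of_commute
      (hr.map (algebraMap R A)) (Commute.all _ _)
    rw [Ideal.eq_top_of_isUnit_mem _ h hu]
    trivial
  refine ⟨hr, fun hs => hy2 ?_⟩
  have := (Ideal.add_mem_iff_right _ (Ideal.mem_map_of_mem (algebraMap R A) hr)).1 h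
  exact (((((maximalIdeal R).map (algebraMap R A)).restrictScalars R).smul_mem_iff_of_isUnit
    hs).1 this)

variable [IsArtinianRing R]

theorem exists_sub_mem_of_isNilpotent (hg : IsNilpotentGenerator R y) {z : A}
    (hz : IsNilpotent z) :
    ∃ b c : R, z - (b • y + c • y ^ 2) ∈ (maximalIdeal R).map (algebraMap R A) := by
  rcases subsingleton_or_nontrivial A with hA | hA
  · refine ⟨0, 0, ?_⟩
    rw [Subsingleton.elim (z - _) (0 : A)]
    exact zero_mem _
  obtain ⟨a, b, c, h⟩ := hg.exists_sub_mem z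
  refine ⟨b, c, ?_⟩
  have ha : a ∈ maximalIdeal R := by
    apply mem_maximalIdeal_of_isNilpotent_algebraMap (A := A)
    have : algebraMap R A a = z - b • y - c • y ^ 2
        - (z - (algebraMap R A a + b • y + c • y ^ 2)) := by ring
    rw [this]
    exact (Commute.all _ _).isNilpotent_sub ((Commute.all _ _).isNilpotent_sub
      ((Commute.all _ _).isNilpotent_sub hz (hg.isNilpotent.smul _))
      ((hg.isNilpotent.pow_of_pos two_ne_zero).smul _)) (isNilpotent_of_mem_map h)
  have : z - (b • y + c • y ^ 2) = z - (algebraMap R A a + b • y + c • y ^ 2)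
    + algebraMap R A a := by ring
  rw [this]
  exact add_mem h (Ideal.mem_map_of_mem _ ha)

theorem pow_two_le (hg : IsNilpotentGenerator R y) {n : Ideal A} (hn : ∀ z ∈ n, IsNilpotent z) :
    n ^ 2 ≤ Ideal.span {y ^ 2} ⊔ (maximalIdeal R).map (algebraMap R A) := by
  have h : n ≤ Ideal.span {y} ⊔ (maximalIdeal R).map (algebraMap R A) := by
    intro z hz
    obtain ⟨b, c, h⟩ := hg.exists_sub_mem_of_isNilpotent (hn z hz)
    refine Submodule.mem_sup.2 ⟨_, Ideal.mem_span_singleton'.2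
      ⟨algebraMap R A b + c • y, rfl⟩, _, h, ?_⟩
    simp only [Algebra.smul_def]; ring
  refine (Ideal.pow_right_mono h 2).trans ?_
  rw [pow_two, Ideal.sup_mul, Ideal.mul_sup, Ideal.span_singleton_mul_span_singleton, ← pow_two]
  exact sup_le (sup_le le_sup_left (Ideal.mul_le_right.trans le_sup_right))
    (Ideal.mul_le_left.trans le_sup_right)

theorem pow_four_le (hg : IsNilpotentGenerator R y) {n : Ideal A}
    (hn : ∀ z ∈ n, IsNilpotent z) : n ^ 4 ≤ (maximalIdeal R).map (algebraMap R A) := by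
  have h := hg.pow_two_le hn
  rw [show (4 : ℕ) = 2 + 2 from rfl, pow_add]
  refine (Ideal.mul_mono h h).trans ?_
  rw [Ideal.sup_mul, Ideal.mul_sup, Ideal.span_singleton_mul_span_singleton]
  refine sup_le (sup_le ?_ Ideal.mul_le_right) Ideal.mul_le_left
  rw [Ideal.span_singleton_le_iff_mem, show y ^ 2 * y ^ 2 = y * y ^ 3 by ring]
  exact Ideal.mul_mem_left _ _ hg.pow_three_mem

theorem quarticSum_le (hg : IsNilpotentGenerator R y) {n : Ideal A}
    (hn : ∀ z ∈ n, IsNilpotent z) :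
    quarticSum R n ≤ maximalIdeal R • (⊤ : Submodule R A) := by
  refine sup_le (sup_le ?_ ?_) ?_
  · exact fun z hz => mem_smul_top_iff.2 (hg.pow_four_le hn hz)
  · exact Submodule.smul_mono le_rfl le_top
  · rintro _ ⟨r, hr, rfl⟩
    exact mem_smul_top_iff.2 (Ideal.mem_map_of_mem _ hr)

/-- By Nakayama it suffices to work modulo `𝔪P` with `P = 𝔪A`. There `P` is spanned by `𝔪`, `𝔪y` and
`𝔪y²`, of which only `𝔪y` is not visibly in the sum. If some `m y` escapes, the pigeonhole gives `m
y = r + s(y² + t m y) + z`; as `y² ∉ 𝔪A`, both `r` and `s` lie in `𝔪`, which puts `m y` back in. -/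
theorem quarticSum_eq [Infinite (R ⧸ maximalIdeal R)] (hg : IsNilpotentGenerator R y)
    (hy2 : y ^ 2 ∉ (maximalIdeal R).map (algebraMap R A)) (hfut : IsFutile R A) {n : Ideal A}
    (hn : ∀ z, z ∈ n ↔ IsNilpotent z) :
    quarticSum R n = maximalIdeal R • (⊤ : Submodule R A) := by
  refine le_antisymm (hg.quarticSum_le fun z hz => (hn z).1 hz) ?_
  have hyn : y ∈ n := (hn y).2 hg.isNilpotent
  have hy2n : y ^ 2 ∈ n ^ 2 := Ideal.pow_mem_pow hyn 2
  have hle := hg.quarticSum_le fun z hz => (hn z).1 hz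
  have h4 : ((n ^ 4).restrictScalars R : Submodule R A) ≤ quarticSum R n :=
    le_sup_left.trans le_sup_left
  have h2 : maximalIdeal R • ((n ^ 2).restrictScalars R : Submodule R A) ≤ quarticSum R n :=
    le_sup_right.trans le_sup_left
  have h1 : Submodule.map (Algebra.linearMap R A) (maximalIdeal R) ≤ quarticSum R n :=
    le_sup_right
  generalize quarticSum R n = Z at *
  set P : Submodule R A := maximalIdeal R • ⊤ with hP
  have hPP : ∀ z ∈ P, ∀ w ∈ P, z * w ∈ maximalIdeal R • P := fun z hz w hw =>
    Submodule.mul_mem_smul_smul_top hz hw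
  have hPl : ∀ a, ∀ z ∈ P, a * z ∈ P := fun a z hz => Submodule.mul_mem_smul (fun _ _ => trivial) hz
  apply Submodule.le_of_le_sup_smul_of_isNilpotent (IsArtinianRing.isNilpotent_maximalIdeal R)
  have hZP : Z ⊔ maximalIdeal R • P ≤ P := sup_le hle Submodule.smul_le_right
  by_cases hmy : ∀ m ∈ maximalIdeal R, m • y ∈ Z ⊔ maximalIdeal R • P
  · refine Submodule.smul_le.2 fun m hm z _ => ?_
    obtain ⟨a, b, c, hz⟩ := hg.exists_sub_mem z
    have : m • z = m • algebraMap R A a + b • m • y + m • c • y ^ 2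
        + m • (z - (algebraMap R A a + b • y + c • y ^ 2)) := by
      simp only [Algebra.smul_def]; ring
    rw [this]
    refine add_mem (add_mem (add_mem (Submodule.mem_sup_left (h1 ⟨m * a,
      Ideal.mul_mem_right _ _ hm, by simp [Algebra.smul_def]⟩)) (Submodule.smul_mem _ _ (hmy m hm)))
      (Submodule.mem_sup_left (h2 (Submodule.smul_mem_smul hm
        (Submodule.smul_mem _ _ hy2n))))) (Submodule.mem_sup_right
        (Submodule.smul_mem_smul hm (mem_smul_top_iff.2 hz)))
  · push Not at hmy
    obtain ⟨m, hm, hw⟩ := hmy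
    have hwP : m • y ∈ P := Submodule.smul_mem_smul hm trivial
    have hy2P : ∀ z ∈ P, y ^ 2 * z ∈ Z := fun z hz => h2 (Submodule.mul_mem_smul
      (fun s _ => Ideal.mul_mem_right _ _ hy2n) hz)
    exfalso
    -- The square of `y² + t m y` has terms in `𝔫⁴`, `𝔪𝔫²` and `𝔪P`: this is where the shape of the
    -- quartic sum comes from.
    obtain ⟨t, r, s, z, hz, he⟩ := hfut.exists_eq_algebraMap_add_smul_add
      (Z ⊔ maximalIdeal R • P) (y ^ 2) (m • y) (fun t => by
        have : (y ^ 2 + t • m • y) * (y ^ 2 + t • m • y) =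
          y ^ 4 + (2 * t) • (y ^ 2 * (m • y)) + (t * t) • ((m • y) * (m • y)) := by
            simp only [Algebra.smul_def, map_mul, map_ofNat]; ring
        rw [this]
        exact add_mem (add_mem (Submodule.mem_sup_left (h4 (Ideal.pow_mem_pow hyn 4)))
          (Submodule.smul_mem _ _ (Submodule.mem_sup_left (hy2P _ hwP))))
          (Submodule.smul_mem _ _ (Submodule.mem_sup_right (hPP _ hwP _ hwP))))
      (fun t z hz => by
        rw [add_mul, smul_mul_assoc]
        exact add_mem (Submodule.mem_sup_left (hy2P _ (hZP hz)))
          (Submodule.smul_mem _ _ (Submodule.mem_sup_right (hPP _ hwP _ (hZP hz)))))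
      (fun z hz z' hz' => Submodule.mem_sup_right (hPP _ (hZP hz) _ (hZP hz')))
    have hrs : algebraMap R A r + s • y ^ 2 ∈ (maximalIdeal R).map (algebraMap R A) := by
      have : algebraMap R A r + s • y ^ 2 = m • y - (s * t) • m • y - z := by
        rw [smul_add, smul_smul] at he
        linear_combination -he
      rw [this]
      exact mem_smul_top_iff.1 (sub_mem (sub_mem hwP (P.smul_mem _ hwP)) (hZP hz))
    obtain ⟨hr, hs⟩ := hg.mem_maximalIdeal_of_add_mem hy2 hrs
    apply hw
    rw [he, smul_add]
    exact add_mem (add_mem (Submodule.mem_sup_left (h1 ⟨r, hr, rfl⟩)) (add_mem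
      (Submodule.mem_sup_left (h2 (Submodule.smul_mem_smul hs hy2n)))
      (Submodule.mem_sup_right (Submodule.smul_mem_smul hs (P.smul_mem _ hwP))))) hz

/-- Since `y³ ∈ 𝔪A`, the square of `x` is `b² y²` modulo `𝔪A`. Hence `S` contains `y²`, then `y`,
modulo `𝔪A`, and Nakayama finishes. -/
theorem eq_top_of_unit_coeff (hg : IsNilpotentGenerator R y) (S : Subalgebra R A) {x : A}
    (hx : x ∈ S) {b c : R} (hb : IsUnit b)
    (hxy : x - (b • y + c • y ^ 2) ∈ (maximalIdeal R).map (algebraMap R A)) : S = ⊤ := by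
  set P : Submodule R A := maximalIdeal R • ⊤ with hP
  have hxy' : x - (b • y + c • y ^ 2) ∈ S.toSubmodule ⊔ P :=
    Submodule.mem_sup_right (mem_smul_top_iff.2 hxy)
  have hxS : x ∈ S.toSubmodule ⊔ P := Submodule.mem_sup_left hx
  have hx2S : x * x ∈ S.toSubmodule ⊔ P := Submodule.mem_sup_left (S.mul_mem hx hx)
  have hy2 : y ^ 2 ∈ S.toSubmodule ⊔ P := by
    rw [← Submodule.smul_mem_iff_of_isUnit _ (hb.mul hb)]
    have : (b * b) • y ^ 2 = x * x - ((x + (b • y + c • y ^ 2)) * (x - (b • y + c • y ^ 2)) +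
        (algebraMap R A (2 * b * c) + algebraMap R A (c * c) * y) * y ^ 3) := by
      simp only [Algebra.smul_def, map_mul, map_ofNat]; ring
    rw [this]
    exact sub_mem hx2S (Submodule.mem_sup_right (mem_smul_top_iff.2
      (add_mem (Ideal.mul_mem_left _ _ hxy) (Ideal.mul_mem_left _ _ hg.pow_three_mem))))
  have hy : y ∈ S.toSubmodule ⊔ P := by
    rw [← Submodule.smul_mem_iff_of_isUnit _ hb,
      show b • y = x - (x - (b • y + c • y ^ 2)) - c • y ^ 2 by abel]
    exact sub_mem (sub_mem hxS hxy') (Submodule.smul_mem _ _ hy2)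
  have : (⊤ : Submodule R A) ≤ S.toSubmodule := by
    refine Submodule.le_of_le_sup_smul_of_isNilpotent (IsArtinianRing.isNilpotent_maximalIdeal R)
      fun z _ => ?_
    obtain ⟨a, b', c', hz⟩ := hg.exists_sub_mem z
    rw [← sub_add_cancel z (algebraMap R A a + b' • y + c' • y ^ 2)]
    exact add_mem (Submodule.mem_sup_right (mem_smul_top_iff.2 hz)) (add_mem (add_mem
      (Submodule.mem_sup_left (S.algebraMap_mem a)) (Submodule.smul_mem _ _ hy))
      (Submodule.smul_mem _ _ hy2))
  exact eq_top_iff.2 fun z hz => this trivial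

/-- If a subalgebra `S` meets `𝔪 A` in a subset of `𝔪 + Q`, contains a nilpotent `x ∉ R + Q`, and
misses a nilpotent `u` with `u ^ 2 ∈ Q`, then the condition on `𝔫⁴ + 𝔫² 𝔪 + 𝔪` fails. -/
theorem false_of_exists_isNilpotent (hg : IsNilpotentGenerator R y) {n : Ideal A}
    (hn : ∀ z ∈ n, IsNilpotent z)
    (hq : y ^ 2 ∉ (maximalIdeal R).map (algebraMap R A) →
      quarticSum R n = maximalIdeal R • (⊤ : Submodule R A))
    (S : Subalgebra R A) (Q : Ideal A) (hQS : Q.restrictScalars R ≤ S.toSubmodule)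
    (hS : S.toSubmodule ⊓ maximalIdeal R • (⊤ : Submodule R A) ≤
      Submodule.map (Algebra.linearMap R A) (maximalIdeal R) ⊔ Q.restrictScalars R)
    {x u : A} (hxS : x ∈ S) (hxn : IsNilpotent x)
    (hxQ : x ∉ Submodule.map (Algebra.linearMap R A) (maximalIdeal R) ⊔ Q.restrictScalars R)
    (huS : u ∉ S) (hun : IsNilpotent u) (huQ : u * u ∈ Q) : False := by
  obtain ⟨b, c, hbc⟩ := hg.exists_sub_mem_of_isNilpotent hxn
  by_cases hb : IsUnit b
  · rw [hg.eq_top_of_unit_coeff S hxS hb hbc] at huS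
    exact huS trivial
  set Z := Submodule.map (Algebra.linearMap R A) (maximalIdeal R) ⊔ Q.restrictScalars R with hZ
  set P : Submodule R A := maximalIdeal R • ⊤ with hP
  have hZS : Z ≤ S.toSubmodule := by
    refine sup_le ?_ hQS
    rintro _ ⟨r, -, rfl⟩
    exact S.algebraMap_mem r
  have hPl : ∀ a, ∀ z ∈ P, a * z ∈ P := fun a z hz => Submodule.mul_mem_smul (fun _ _ => trivial) hz
  have hPP : ∀ z ∈ P, ∀ w ∈ P, z * w ∈ maximalIdeal R • P := fun z hz w hw =>
    Submodule.mul_mem_smul_smul_top hz hw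
  have hxc : x - c • y ^ 2 ∈ P := by
    rw [show x - c • y ^ 2 = x - (b • y + c • y ^ 2) + b • y by abel]
    exact add_mem (mem_smul_top_iff.2 hbc) (Submodule.smul_mem_smul hb trivial)
  -- Modulo `𝔪A` only `c y²` is left of `x`; were `c` in `𝔪`, then `x` would lie in `S ∩ 𝔪A`, hence
  -- in `Z`.
  have hc : IsUnit c := by
    by_contra hc
    refine hxQ (hS ⟨hxS, ?_⟩)
    rw [← sub_add_cancel x (c • y ^ 2)]
    exact add_mem hxc (Submodule.smul_mem_smul hc trivial)
  clear hbc hb hxn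
  obtain ⟨x, hxS, hxQ, hxP⟩ : ∃ x ∈ S, x ∉ Z ∧ x - y ^ 2 ∈ P := by
    obtain ⟨d, hd⟩ := hc.exists_left_inv
    have hdu : IsUnit d := IsUnit.of_mul_eq_one c hd
    refine ⟨d • x, S.smul_mem hxS d, fun h => hxQ ((Z.smul_mem_iff_of_isUnit hdu).1 h), ?_⟩
    have := P.smul_mem d hxc
    rwa [smul_sub, smul_smul, hd, one_smul] at this
  have hy3 : y ^ 3 ∈ P := mem_smul_top_iff.2 hg.pow_three_mem
  have hy2 : y ^ 2 ∉ (maximalIdeal R).map (algebraMap R A) := fun h => by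
    refine hxQ (hS ⟨hxS, ?_⟩)
    rw [← sub_add_cancel x (y ^ 2)]
    exact add_mem hxP (mem_smul_top_iff.2 h)
  replace hq := hq hy2
  have hxy : x * y ∈ P := by
    rw [show x * y = y * (x - y ^ 2) + y ^ 3 by ring]
    exact add_mem (hPl _ _ hxP) hy3
  have hxx : x * x ∈ P := by
    rw [show x * x = x * (x - y ^ 2) + y * (x * y) by ring]
    exact add_mem (hPl _ _ hxP) (hPl _ _ hxy)
  have hmx : ∀ m ∈ maximalIdeal R, m • x ∈ Z := fun m hm =>
    hS ⟨S.smul_mem hxS m, Submodule.smul_mem_smul hm trivial⟩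
  -- After rescaling, `x` agrees with `y²` modulo `𝔪A`, so it can replace `y²` in the spanning set.
  have hspan : ∀ z : A, ∃ a b c : R, z = algebraMap R A a + b • y + c • x := by
    have hE : (⊤ : Submodule R A) ≤ Submodule.span R {1, y, x} := by
      refine Submodule.le_of_le_sup_smul_of_isNilpotent
        (IsArtinianRing.isNilpotent_maximalIdeal R) fun z _ => ?_
      obtain ⟨a, b, c, hz⟩ := hg.exists_sub_mem z
      refine Submodule.mem_sup.2 ⟨a • 1 + b • y + c • x, ?_,
        z - (algebraMap R A a + b • y + c • y ^ 2) - c • (x - y ^ 2), ?_, ?_⟩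
      · exact add_mem (add_mem (Submodule.smul_mem _ _ (Submodule.subset_span (by simp)))
          (Submodule.smul_mem _ _ (Submodule.subset_span (by simp))))
          (Submodule.smul_mem _ _ (Submodule.subset_span (by simp)))
      · exact sub_mem (mem_smul_top_iff.2 hz) (P.smul_mem _ hxP)
      · simp only [Algebra.smul_def]; ring
    intro z
    obtain ⟨a, b, c, h⟩ := Submodule.mem_span_triple.1 (hE (show z ∈ ⊤ from trivial))
    exact ⟨a, b, c, by rw [← h, Algebra.smul_def a, mul_one]⟩
  -- The aim is `P ≤ Z`. By Nakayama and the quartic condition, it suffices that `𝔫⁴`, `𝔪𝔫²` and `𝔪`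
  -- lie in `W`. The input is that `𝔪x` and `x²` lie in `S ∩ 𝔪A`, hence in `Z`.
  set W := Z ⊔ maximalIdeal R • P with hW
  have hPPW : ∀ z ∈ P, ∀ w ∈ P, z * w ∈ W := fun z hz w hw =>
    Submodule.mem_sup_right (hPP z hz w hw)
  have hxP' : ∀ z ∈ P, x * z ∈ W := by
    intro z hz
    refine Submodule.smul_induction_on hz (fun m hm w _ => ?_) fun z w hz hw => ?_
    · obtain ⟨a, b, c, rfl⟩ := hspan w
      have : x * m • (algebraMap R A a + b • y + c • x) =
        a • m • x + b • m • (x * y) + c • m • (x * x) := by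
          simp only [Algebra.smul_def]; ring
      rw [this]
      exact add_mem (add_mem (W.smul_mem _ (Submodule.mem_sup_left (hmx m hm)))
        (W.smul_mem _ (Submodule.mem_sup_right (Submodule.smul_mem_smul hm hxy))))
        (W.smul_mem _ (Submodule.mem_sup_right (Submodule.smul_mem_smul hm hxx)))
    · rw [mul_add]; exact add_mem hz hw
  have hy2P : ∀ z ∈ P, y ^ 2 * z ∈ W := by
    intro z hz
    rw [show y ^ 2 * z = x * z - (x - y ^ 2) * z by ring]
    exact sub_mem (hxP' z hz) (hPPW _ hxP _ hz)
  have hy4 : ∀ z, y ^ 4 * z ∈ W := by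
    intro z
    obtain ⟨a, b, c, rfl⟩ := hspan z
    have : y ^ 4 * (algebraMap R A a + b • y + c • x) =
        a • (x * x - (2 : R) • (x * (x - y ^ 2)) + (x - y ^ 2) * (x - y ^ 2))
          + b • (y ^ 2 * y ^ 3) + c • ((x * y) * y ^ 3) := by
      simp only [Algebra.smul_def, map_ofNat]; ring
    rw [this]
    exact add_mem (add_mem (W.smul_mem _ (add_mem (sub_mem
      (Submodule.mem_sup_left (hS ⟨S.mul_mem hxS hxS, hxx⟩))
      (W.smul_mem _ (hxP' _ hxP))) (hPPW _ hxP _ hxP)))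
      (W.smul_mem _ (hy2P _ hy3))) (W.smul_mem _ (hPPW _ hxy _ hy3))
  have hn2 : ∀ z ∈ n ^ 2, ∃ g, ∃ i ∈ P, z = y ^ 2 * g + i := by
    intro z hz
    obtain ⟨_, h1, i, hi, rfl⟩ := Submodule.mem_sup.1 (hg.pow_two_le hn hz)
    obtain ⟨g, rfl⟩ := Ideal.mem_span_singleton.1 h1
    exact ⟨g, i, mem_smul_top_iff.2 hi, rfl⟩
  have hPZ : P ≤ Z := by
    apply Submodule.le_of_le_sup_smul_of_isNilpotent (IsArtinianRing.isNilpotent_maximalIdeal R)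
    rw [← hq]
    refine sup_le (sup_le ?_ ?_) (le_sup_left.trans le_sup_left)
    · intro z hz
      replace hz : z ∈ n ^ 2 * n ^ 2 := by rw [← pow_add]; exact hz
      rw [hq, ← hW]
      refine Submodule.mul_induction_on hz (fun p hp q hq => ?_) fun z w hz hw => add_mem hz hw
      obtain ⟨g, i, hi, rfl⟩ := hn2 p hp
      obtain ⟨g', i', hi', rfl⟩ := hn2 q hq
      rw [show (y ^ 2 * g + i) * (y ^ 2 * g' + i') = y ^ 4 * (g * g') + y ^ 2 * (g * i')
        + y ^ 2 * (g' * i) + i * i' by ring]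
      exact add_mem (add_mem (add_mem (hy4 _) (hy2P _ (hPl _ _ hi'))) (hy2P _ (hPl _ _ hi)))
        (hPPW _ hi _ hi')
    · rw [hq, ← hW]
      refine Submodule.smul_le.2 fun m hm z hz => ?_
      obtain ⟨g, i, hi, rfl⟩ := hn2 z hz
      rw [smul_add, ← mul_smul_comm]
      exact add_mem (hy2P _ (Submodule.smul_mem_smul hm trivial))
        (Submodule.mem_sup_right (Submodule.smul_mem_smul hm hi))
  obtain ⟨a, b, c, hu⟩ := hspan u
  -- If `b` is not a unit, `u` lies in `R + P + R x`, inside `S`. If it is, expanding `u² ∈ Q`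
  -- isolates `b² y²` modulo `P`, so `y²` and then `x` fall into `Z`; both cases are contradictory.
  by_cases hb : IsUnit b
  swap
  · refine huS (hu ▸ add_mem (add_mem (S.algebraMap_mem a) ?_) (S.smul_mem hxS c))
    exact hZS (hPZ (Submodule.smul_mem_smul hb trivial))
  have ha : algebraMap R A a ∈ P := by
    have : Nontrivial A := ⟨u, 0, fun h => huS (h ▸ zero_mem S)⟩
    refine mem_smul_top_iff.2 (Ideal.mem_map_of_mem _
      (mem_maximalIdeal_of_isNilpotent_algebraMap (A := A) ?_))
    have hxn : IsNilpotent x := by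
      rw [← sub_add_cancel x (y ^ 2)]
      exact (Commute.all _ _).isNilpotent_add (isNilpotent_of_mem_map (mem_smul_top_iff.1 hxP))
        (hg.isNilpotent.pow_of_pos two_ne_zero)
    rw [show algebraMap R A a = u - b • y - c • x by rw [hu]; ring]
    exact (Commute.all _ _).isNilpotent_sub ((Commute.all _ _).isNilpotent_sub hun
      (hg.isNilpotent.smul _)) (hxn.smul _)
  have hy2Z : y ^ 2 ∈ Z := by
    rw [← Submodule.smul_mem_iff_of_isUnit _ (hb.mul hb)]
    have : (b * b) • y ^ 2 = u * u - ((u + b • y + c • x) * algebraMap R A a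
        + (2 * b * c) • (x * y) + (c * c) • (x * x)) := by
      rw [hu]
      simp only [Algebra.smul_def, map_mul, map_ofNat]; ring
    rw [this]
    exact sub_mem (Submodule.mem_sup_right huQ) (hPZ (add_mem (add_mem (hPl _ _ ha)
      (P.smul_mem _ hxy)) (P.smul_mem _ hxx)))
  apply hxQ
  rw [← sub_add_cancel x (y ^ 2)]
  exact add_mem (hPZ hxP) hy2Z

end IsNilpotentGenerator

end

/-- The subalgebra `S + Q`, for an ideal `Q`. -/
def Subalgebra.addIdeal {R A : Type*} [CommRing R] [CommRing A] [Algebra R A]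
    (S : Subalgebra R A) (Q : Ideal A) : Subalgebra R A :=
  (S.map (Ideal.Quotient.mkₐ R Q)).comap (Ideal.Quotient.mkₐ R Q)

namespace Subalgebra

variable {R A : Type*} [CommRing R] [CommRing A] [Algebra R A] {S : Subalgebra R A} {Q : Ideal A}

theorem mem_addIdeal {a : A} : a ∈ S.addIdeal Q ↔ ∃ s ∈ S, a - s ∈ Q := by
  refine exists_congr fun s => and_congr_right fun _ => ?_
  exact eq_comm.trans (Ideal.Quotient.mk_eq_mk_iff_sub_mem _ _)

theorem le_addIdeal : S ≤ S.addIdeal Q := fun a ha =>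
  mem_addIdeal.2 ⟨a, ha, by rw [sub_self]; exact zero_mem _⟩

theorem mem_addIdeal_of_mem {a : A} (ha : a ∈ Q) : a ∈ S.addIdeal Q :=
  mem_addIdeal.2 ⟨0, zero_mem _, by rwa [sub_zero]⟩

theorem addIdeal_eq_self (h : ∀ q ∈ Q, q ∈ S) : S.addIdeal Q = S := by
  refine le_antisymm (fun a ha => ?_) le_addIdeal
  obtain ⟨s, hs, h'⟩ := mem_addIdeal.1 ha
  simpa using add_mem (h _ h') hs

end Subalgebra

/-! ### Uniseriality of `𝔪(A/R)`. -/

section Uniserial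

variable {R A : Type*} [CommRing R] [IsLocalRing R] [CommRing A] [Algebra R A]

theorem isUniserial_smul_modBase_iff :
    IsUniserial R
      (maximalIdeal R • (⊤ : Submodule R (ModBase R A)) : Submodule R (ModBase R A)) ↔
    ∀ N P : Submodule R A, LinearMap.range (Algebra.linearMap R A) ≤ N →
      LinearMap.range (Algebra.linearMap R A) ≤ P →
      N ≤ LinearMap.range (Algebra.linearMap R A) ⊔ maximalIdeal R • ⊤ →
      P ≤ LinearMap.range (Algebra.linearMap R A) ⊔ maximalIdeal R • ⊤ → N ≤ P ∨ P ≤ N := by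
  set U := LinearMap.range (Algebra.linearMap R A) with hU
  have hM : maximalIdeal R • (⊤ : Submodule R (A ⧸ U)) =
      (maximalIdeal R • (⊤ : Submodule R A)).map U.mkQ := by
    rw [Submodule.map_smul'', Submodule.map_top, Submodule.range_mkQ]
  constructor
  · intro h N P hN hP hN' hP'
    have key : ∀ N P : Submodule R A, U ≤ P → N ≤ U ⊔ maximalIdeal R • ⊤ →
        (N.map U.mkQ).comap (maximalIdeal R • (⊤ : Submodule R (A ⧸ U))).subtype ≤
        (P.map U.mkQ).comap (maximalIdeal R • (⊤ : Submodule R (A ⧸ U))).subtype → N ≤ P := by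
      intro N P hP hN hle z hz
      have h1 : U.mkQ z ∈ maximalIdeal R • (⊤ : Submodule R (A ⧸ U)) := by
        rw [hM]
        have := Submodule.mem_map_of_mem (f := U.mkQ) (hN hz)
        rwa [Submodule.map_sup, Submodule.mkQ_map_self, bot_sup_eq] at this
      have h2 : U.mkQ z ∈ P.map U.mkQ :=
        hle (show (⟨U.mkQ z, h1⟩ : ↥(maximalIdeal R • (⊤ : Submodule R (A ⧸ U)))) ∈ _ from
          Submodule.mem_map_of_mem hz)
      have h3 : z ∈ (P.map U.mkQ).comap U.mkQ := h2
      rwa [Submodule.comap_map_mkQ, sup_eq_right.2 hP] at h3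
    exact (h _ _).imp (key N P hP hN') (key P N hN hP')
  · intro h N P
    have key : ∀ N : Submodule R (maximalIdeal R • (⊤ : Submodule R (A ⧸ U)) :
        Submodule R (A ⧸ U)), U ≤ (N.map (Submodule.subtype _)).comap U.mkQ ∧
        (N.map (Submodule.subtype _)).comap U.mkQ ≤ U ⊔ maximalIdeal R • ⊤ := by
      intro N
      refine ⟨Submodule.le_comap_mkQ _ _, ?_⟩
      rw [← Submodule.comap_map_mkQ, ← hM]
      exact Submodule.comap_mono (Submodule.map_subtype_le _ _)
    have key' : ∀ N P : Submodule R (maximalIdeal R • (⊤ : Submodule R (A ⧸ U)) :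
        Submodule R (A ⧸ U)), (N.map (Submodule.subtype _)).comap U.mkQ ≤
        (P.map (Submodule.subtype _)).comap U.mkQ → N ≤ P := fun N P hle =>
      (Submodule.map_le_map_iff_of_injective (Submodule.subtype_injective _) _ _).1
        ((Submodule.comap_le_comap_iff_of_surjective U.mkQ_surjective).1 hle)
    exact (h _ _ (key N).1 (key P).1 (key N).2 (key P).2).imp (key' _ _) (key' _ _)

variable [IsArtinianRing R]

/-- If `N` contains some `u ∈ 𝔪^i A` outside `R + 𝔪^(i+1) A`, the pigeonhole gives `u = r + s(v + t
u) + z` for each `v ∈ 𝔪^i A`. Here `s` must be a unit, so `v ∈ N + 𝔪^(i+1) A`, and Nakayama applies.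
-/
theorem IsFutile.pow_smul_top_le_or_le [Infinite (R ⧸ maximalIdeal R)] (h : IsFutile R A)
    {i : ℕ} (hi : 1 ≤ i) {N : Submodule R A} (hN : LinearMap.range (Algebra.linearMap R A) ≤ N)
    (hNi : N ≤ LinearMap.range (Algebra.linearMap R A) ⊔ maximalIdeal R ^ i • ⊤) :
    maximalIdeal R ^ i • ⊤ ≤ N ∨
      N ≤ LinearMap.range (Algebra.linearMap R A) ⊔ maximalIdeal R ^ (i + 1) • ⊤ := by
  rw [or_iff_not_imp_right, SetLike.not_le_iff_exists]
  rintro ⟨u', hu'N, hu'⟩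
  obtain ⟨r', hr', u, hu, rfl⟩ := Submodule.mem_sup.1 (hNi hu'N)
  have huN : u ∈ N := (N.add_mem_iff_right (hN hr')).1 hu'N
  have huQ : u ∉ LinearMap.range (Algebra.linearMap R A) ⊔ maximalIdeal R ^ (i + 1) • ⊤ :=
    fun hmem => hu' (add_mem (Submodule.mem_sup_left hr') hmem)
  have hsucc : maximalIdeal R • maximalIdeal R ^ i • (⊤ : Submodule R A) =
      maximalIdeal R ^ (i + 1) • ⊤ := by rw [pow_succ', Submodule.mul_smul]
  apply Submodule.le_of_le_sup_smul_of_isNilpotent (IsArtinianRing.isNilpotent_maximalIdeal R)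
  rw [hsucc]
  intro v hv
  obtain ⟨t, r, s, z, hz, he⟩ := h.exists_eq_algebraMap_add_smul_add
    (maximalIdeal R ^ (i + 1) • ⊤) v u (fun t => by
      have hm : v + t • u ∈ maximalIdeal R ^ i • (⊤ : Submodule R A) :=
        add_mem hv (Submodule.smul_mem _ _ hu)
      have := Submodule.mul_mem_smul_smul_top hm hm
      rw [← Submodule.mul_smul, ← pow_add] at this
      -- Squares land in `𝔪^(2i) A`, and `2i ≥ i + 1` because `i ≥ 1`.
      exact Submodule.smul_mono_left (Ideal.pow_le_pow_right (by omega)) this)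
    (fun t z hz => Submodule.mul_mem_smul (fun _ _ => trivial) hz)
    (fun z _ w hw => Submodule.mul_mem_smul (fun _ _ => trivial) hw)
  by_cases hs : IsUnit s
  · rw [← Submodule.smul_mem_iff_of_isUnit _ hs,
      show s • v = u - algebraMap R A r - s • t • u - z by
        rw [smul_add] at he; linear_combination -he]
    exact sub_mem (Submodule.mem_sup_left (sub_mem (sub_mem huN (hN ⟨r, rfl⟩))
      (N.smul_mem _ (N.smul_mem _ huN)))) (Submodule.mem_sup_right hz)
  · refine absurd ?_ huQ
    rw [he]
    refine add_mem (add_mem (Submodule.mem_sup_left ⟨r, rfl⟩) (Submodule.mem_sup_right ?_))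
      (Submodule.mem_sup_right hz)
    rw [← hsucc]
    exact Submodule.smul_mem_smul hs (add_mem hv (Submodule.smul_mem _ _ hu))

/-- Descending through the layers, every submodule between `R` and `R + 𝔪A` turns out to be some `R
+ 𝔪^j A`, and these form a chain. -/
theorem IsFutile.isUniserial_smul_modBase [Infinite (R ⧸ maximalIdeal R)] (h : IsFutile R A) :
    IsUniserial R
      (maximalIdeal R • (⊤ : Submodule R (ModBase R A)) : Submodule R (ModBase R A)) := by
  rw [isUniserial_smul_modBase_iff]
  set U := LinearMap.range (Algebra.linearMap R A)
  have key : ∀ N : Submodule R A, U ≤ N → N ≤ U ⊔ maximalIdeal R • ⊤ →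
      ∃ j : ℕ, N = U ⊔ maximalIdeal R ^ j • ⊤ := by
    intro N hN hN1
    have step : ∀ i : ℕ, (∃ j : ℕ, N = U ⊔ maximalIdeal R ^ j • ⊤) ∨
        N ≤ U ⊔ maximalIdeal R ^ (i + 1) • ⊤ := by
      intro i
      induction i with
      | zero => exact Or.inr (by simpa using hN1)
      | succ i ih =>
        refine ih.elim Or.inl fun hle => ?_
        refine (h.pow_smul_top_le_or_le (Nat.le_add_left 1 i) hN hle).imp (fun h' => ?_) id
        exact ⟨_, le_antisymm hle (sup_le hN h')⟩
    obtain ⟨n, hn⟩ := IsArtinianRing.isNilpotent_maximalIdeal R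
    refine (step n).elim id fun hle => ⟨n + 1, le_antisymm hle (sup_le hN ?_)⟩
    rw [pow_succ, hn, zero_mul, Ideal.zero_eq_bot, Submodule.bot_smul]
    exact bot_le
  intro N P hN hP hN' hP'
  obtain ⟨i, rfl⟩ := key N hN hN'
  obtain ⟨j, rfl⟩ := key P hP hP'
  exact (le_total j i).imp
    (fun h => sup_le_sup_left (Submodule.smul_mono_left (Ideal.pow_le_pow_right h)) _)
    (fun h => sup_le_sup_left (Submodule.smul_mono_left (Ideal.pow_le_pow_right h)) _)

end Uniserial

/-! ### Comparing two subalgebras that differ along one layer. -/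

section Comparison

variable {R A : Type*} [CommRing R] [CommRing A] [Algebra R A]

theorem exists_eq_algebraMap_add_of_mem_basePlusNil (z : basePlusNil R A) :
    ∃ r : R, ∃ x : basePlusNil R A, IsNilpotent x ∧ z = algebraMap R _ r + x := by
  obtain ⟨_, r, x, hx, rfl⟩ := z
  refine ⟨r, ⟨x, 0, x, hx, by simp⟩, ?_, rfl⟩
  exact (IsNilpotent.map_iff (f := (basePlusNil R A).val) Subtype.val_injective).1 hx

theorem mem_nilIdeal_iff {z : basePlusNil R A} : z ∈ nilIdeal R A ↔ IsNilpotent z :=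
  IsNilpotent.map_iff (f := (basePlusNil R A).val) Subtype.val_injective

/-- Two subalgebras that agree modulo `R u + Q` and meet `𝔪 A` in a subset of `𝔪 + Q` are
comparable. -/
theorem Subalgebra.le_of_forall_exists_sub_smul_mem [IsLocalRing R] [IsArtinianRing R]
    [Module.Finite R A] {y : basePlusNil R A}
    (hg : IsNilpotentGenerator R y)
    (hq : y ^ 2 ∉ (maximalIdeal R).map (algebraMap R (basePlusNil R A)) →
      quarticSum R (nilIdeal R A) = maximalIdeal R • (⊤ : Submodule R (basePlusNil R A)))
    {C D : Subalgebra R A} {Q : Ideal A} {u : A}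
    (hQm : Q ≤ (maximalIdeal R).map (algebraMap R A))
    (hQC : ∀ q ∈ Q, q ∈ C) (hQD : ∀ q ∈ Q, q ∈ D)
    (hD : ∀ z ∈ D, z ∈ (maximalIdeal R).map (algebraMap R A) →
      ∃ r ∈ maximalIdeal R, z - algebraMap R A r ∈ Q)
    (hu : u ∈ (maximalIdeal R).map (algebraMap R A)) (huD : u ∉ D) (huu : u * u ∈ Q)
    (hAu : ∀ z : A, ∃ r s : R, z * u - (algebraMap R A r + s • u) ∈ Q)
    (hDC : ∀ d ∈ D, ∃ s : R, d - s • u ∈ C) : D ≤ C := by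
  have hA : Nontrivial A := ⟨u, 0, fun h => huD (h ▸ zero_mem D)⟩
  by_contra hle
  obtain ⟨b, hbD, hbC⟩ := SetLike.not_le_iff_exists.1 hle
  -- Subtracting from `b` the scalar by which it acts on `u` makes `b u` congruent modulo `Q` to an
  -- element of `𝔪`.
  obtain ⟨b, hbD, hbC, r, hr, hbu⟩ : ∃ b ∈ D, b ∉ C ∧ ∃ r ∈ maximalIdeal R,
      b * u - algebraMap R A r ∈ Q := by
    obtain ⟨r, s, h⟩ := hAu b
    have h' : (b - algebraMap R A s) * u - algebraMap R A r ∈ Q := by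
      convert h using 1
      simp only [Algebra.smul_def]; ring
    refine ⟨b - algebraMap R A s, sub_mem hbD (D.algebraMap_mem s), fun hmem => hbC ?_, r, ?_, h'⟩
    · simpa using add_mem hmem (C.algebraMap_mem s)
    · apply mem_maximalIdeal_of_isNilpotent_algebraMap (A := A)
      apply isNilpotent_of_mem_map (R := R)
      rw [← sub_sub_cancel ((b - algebraMap R A s) * u) (algebraMap R A r)]
      exact sub_mem (Ideal.mul_mem_left _ _ hu) (hQm h')
  have hCQ : ∀ {z : A} {r : R}, z - algebraMap R A r ∈ Q → z ∈ C := fun {z r} h => by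
    simpa using add_mem (hQC _ h) (C.algebraMap_mem r)
  obtain ⟨s, hs⟩ := hDC b hbD
  -- Modulo `Q`, `b² u` is `r b`, which lies in `D ∩ 𝔪A` and so in `𝔪 + Q`.
  have hb2u : b ^ 2 * u ∈ C := by
    obtain ⟨r', hr', h⟩ := hD (r • b) (D.smul_mem hbD r) (smul_mem_map hr b)
    refine hCQ (r := r') ?_
    rw [show b ^ 2 * u - algebraMap R A r' = b * (b * u - algebraMap R A r) +
      (r • b - algebraMap R A r') by rw [Algebra.smul_def]; ring]
    exact add_mem (Ideal.mul_mem_left _ _ hbu) h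
  have hb2 : b ^ 2 ∈ C := by
    rw [show b ^ 2 = (b - s • u) * (b - s • u) + (2 * s) • (b * u) - (s * s) • (u * u) by
      simp only [Algebra.smul_def, map_mul, map_ofNat]; ring]
    exact sub_mem (add_mem (mul_mem hs hs) (C.smul_mem (hCQ hbu) _)) (C.smul_mem (hQC _ huu) _)
  have hb2D : ∀ c ∈ D, b ^ 2 * c ∈ C := by
    intro c hc
    obtain ⟨s', hs'⟩ := hDC c hc
    rw [show b ^ 2 * c = b ^ 2 * (c - s' • u) + s' • (b ^ 2 * u) by
      simp only [Algebra.smul_def]; ring]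
    exact add_mem (mul_mem hb2 hs') (C.smul_mem hb2u _)
  -- Fitting-style splitting: `D` is artinian, so `b^(n+1) c = b^n` for some `c ∈ D`. Then `b - b²
  -- c` is nilpotent and differs from `b` by an element of `C`.
  obtain ⟨x, hxD, hxC, hxn⟩ : ∃ x ∈ D, x ∉ C ∧ IsNilpotent x := by
    have : IsArtinian R D := inferInstanceAs (IsArtinian R D.toSubmodule)
    have : IsArtinianRing D := isArtinian_of_tower R this
    obtain ⟨n, c, hc⟩ := IsArtinian.exists_pow_succ_smul_dvd (⟨b, hbD⟩ : D) (1 : D)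
    replace hc : b ^ (n + 1) * c = b ^ n := by simpa using congrArg Subtype.val hc
    refine ⟨b - b ^ 2 * c, sub_mem hbD (mul_mem (pow_mem hbD 2) c.2), fun hmem => hbC ?_,
      n + 1, ?_⟩
    · simpa using add_mem hmem (hb2D c c.2)
    · rw [show b - b ^ 2 * c = b * (1 - b * c) by ring, mul_pow, pow_succ (1 - b * c),
        show b ^ (n + 1) * ((1 - b * (c : A)) ^ n * (1 - b * c)) =
          b * (1 - b * c) ^ n * (b ^ n - b ^ (n + 1) * c) by ring, hc, sub_self, mul_zero]
  have hun : IsNilpotent u := isNilpotent_of_mem_map hu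
  let T := basePlusNil R A
  have hTn : ∀ {z : A}, IsNilpotent z → z ∈ T := fun {z} hz => ⟨0, z, hz, by simp⟩
  refine hg.false_of_exists_isNilpotent (fun z hz => mem_nilIdeal_iff.1 hz) hq (D.comap T.val)
    (Q.comap T.val) (fun z hz => hQD _ hz) ?_ (x := ⟨x, hTn hxn⟩) (u := ⟨u, hTn hun⟩) hxD
    (mem_nilIdeal_iff.1 hxn) ?_ huD (mem_nilIdeal_iff.1 hun) huu
  · rintro z ⟨hzD, hzm⟩
    have hz : (z : A) ∈ (maximalIdeal R).map (algebraMap R A) := by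
      have hle : (maximalIdeal R).map (algebraMap R T) ≤
          ((maximalIdeal R).map (algebraMap R A)).comap T.val :=
        Ideal.map_le_iff_le_comap.2 fun r hr => Ideal.mem_map_of_mem (algebraMap R A) hr
      exact hle (mem_smul_top_iff.1 hzm)
    obtain ⟨r, hr, h⟩ := hD z hzD hz
    exact Submodule.mem_sup.2 ⟨algebraMap R T r, ⟨r, hr, rfl⟩, z - algebraMap R T r, h, by abel⟩
  · intro hx
    obtain ⟨_, ⟨r, -, rfl⟩, q, hq, hx⟩ := Submodule.mem_sup.1 hx
    apply hxC
    have : x = algebraMap R A r + q := (congrArg Subtype.val hx).symm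
    rw [this]
    exact add_mem (C.algebraMap_mem r) (hQC _ hq)

end Comparison

/-! ### Counting subalgebras layer by layer. -/

section Finiteness

variable {R A : Type*} [CommRing R] [IsLocalRing R] [CommRing A] [Algebra R A]

/-- Compare `R + R u + Q` with `R + R v + Q`, where `Q = 𝔪^(j+2) A`. If `u = r + s v` modulo `Q`,
then `s` is a unit, since `𝔪v` lies in `Q` and `u ∉ R + Q`; solve for `v`. -/
theorem exists_sub_mem_of_isUniserial
    (hU : IsUniserial R
      (maximalIdeal R • (⊤ : Submodule R (ModBase R A)) : Submodule R (ModBase R A)))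
    {j : ℕ} {u v : A}
    (hu : u ∈ (maximalIdeal R ^ (j + 1)).map (algebraMap R A))
    (hv : v ∈ (maximalIdeal R ^ (j + 1)).map (algebraMap R A))
    (huQ : ∀ r : R, u - algebraMap R A r ∉ (maximalIdeal R ^ (j + 2)).map (algebraMap R A)) :
    ∃ r s : R, v - (algebraMap R A r + s • u) ∈
      (maximalIdeal R ^ (j + 2)).map (algebraMap R A) := by
  rw [isUniserial_smul_modBase_iff] at hU
  set Q := (maximalIdeal R ^ (j + 2)).map (algebraMap R A) with hQ
  set U := LinearMap.range (Algebra.linearMap R A)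
  let N (w : A) : Submodule R A := U ⊔ Submodule.span R {w} ⊔ Q.restrictScalars R
  have hI : ∀ i, (maximalIdeal R ^ (i + 1)).map (algebraMap R A) ≤
      (maximalIdeal R).map (algebraMap R A) := fun i =>
    Ideal.map_mono (Ideal.pow_le_self (Nat.succ_ne_zero i))
  have hN : ∀ w ∈ (maximalIdeal R).map (algebraMap R A), N w ≤ U ⊔ maximalIdeal R • ⊤ :=
    fun w hw => sup_le (sup_le le_sup_left ((Submodule.span_singleton_le_iff_mem _ _).2
      (Submodule.mem_sup_right (mem_smul_top_iff.2 hw))))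
      fun q hq => Submodule.mem_sup_right (mem_smul_top_iff.2 (hI _ hq))
  have hself : ∀ w, w ∈ N w := fun w => Submodule.mem_sup_left (Submodule.mem_sup_right
    (Submodule.mem_span_singleton_self w))
  have hmem : ∀ {w z}, z ∈ N w → ∃ r s : R, z - (algebraMap R A r + s • w) ∈ Q := by
    intro w z hz
    obtain ⟨_, h1, q, hq, rfl⟩ := Submodule.mem_sup.1 hz
    obtain ⟨_, ⟨r, rfl⟩, _, h2, rfl⟩ := Submodule.mem_sup.1 h1
    obtain ⟨s, rfl⟩ := Submodule.mem_span_singleton.1 h2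
    exact ⟨r, s, by simpa using hq⟩
  rcases hU (N u) (N v) (le_sup_left.trans le_sup_left) (le_sup_left.trans le_sup_left)
    (hN u (hI _ hu)) (hN v (hI _ hv)) with h | h
  · obtain ⟨r, s, hs⟩ := hmem (h (hself u))
    by_cases hsu : IsUnit s
    · obtain ⟨d, hd⟩ := hsu.exists_left_inv
      refine ⟨-(d * r), d, ?_⟩
      have := Q.mul_mem_left (algebraMap R A (-d)) hs
      convert this using 1
      have hd' : algebraMap R A d * algebraMap R A s = 1 := by rw [← map_mul, hd, map_one]
      simp only [Algebra.smul_def, map_neg, map_mul]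
      linear_combination - v * hd'
    · refine absurd ?_ (huQ r)
      have hsv : s • v ∈ Q := by
        rw [Algebra.smul_def, hQ, pow_succ' _ (j + 1), Ideal.map_mul]
        exact Ideal.mul_mem_mul (Ideal.mem_map_of_mem _ hsu) hv
      rw [show u - algebraMap R A r = u - (algebraMap R A r + s • v) + s • v by ring]
      exact add_mem hs hsv
  · exact hmem (h (hself v))

variable [IsArtinianRing R]

/-- Uniseriality places `C ∩ (R + 𝔪A)` inside `R + 𝔪^(j+1) A`. An element of it outside `R + 𝔪^(j+2)
A` would generate the whole layer and force it into `C`. -/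
theorem exists_sub_mem_of_not_le
    (hU : IsUniserial R
      (maximalIdeal R • (⊤ : Submodule R (ModBase R A)) : Submodule R (ModBase R A)))
    {j : ℕ} {C : Subalgebra R A}
    (hQC : ∀ q ∈ (maximalIdeal R ^ (j + 2)).map (algebraMap R A), q ∈ C)
    (hC : ¬ ∀ q ∈ (maximalIdeal R ^ (j + 1)).map (algebraMap R A), q ∈ C)
    {z : A} (hzC : z ∈ C) (hz : z ∈ (maximalIdeal R).map (algebraMap R A)) :
    ∃ r ∈ maximalIdeal R,
      z - algebraMap R A r ∈ (maximalIdeal R ^ (j + 2)).map (algebraMap R A) := by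
  have hA : Nontrivial A := by
    by_contra hA
    rw [not_nontrivial_iff_subsingleton] at hA
    exact hC fun q _ => Subsingleton.elim 0 q ▸ zero_mem C
  suffices h : ∃ r : R, z - algebraMap R A r ∈
      (maximalIdeal R ^ (j + 2)).map (algebraMap R A) by
    obtain ⟨r, hr⟩ := h
    refine ⟨r, mem_maximalIdeal_of_isNilpotent_algebraMap (A := A)
      (isNilpotent_of_mem_map (R := R) ?_), hr⟩
    rw [← sub_sub_cancel z (algebraMap R A r)]
    exact sub_mem hz (Ideal.map_mono (Ideal.pow_le_self (Nat.succ_ne_zero _)) hr)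
  have hU' := isUniserial_smul_modBase_iff.1 hU
  set U := LinearMap.range (Algebra.linearMap R A)
  have hUC : U ≤ C.toSubmodule := by rintro _ ⟨r, rfl⟩; exact C.algebraMap_mem r
  set I := (maximalIdeal R ^ (j + 1)).map (algebraMap R A) with hI
  have hIm : I.restrictScalars R ≤ U ⊔ maximalIdeal R • ⊤ := fun q hq =>
    Submodule.mem_sup_right (mem_smul_top_iff.2 (Ideal.map_mono
      (Ideal.pow_le_self (Nat.succ_ne_zero _)) hq))
  rcases hU' (U ⊔ I.restrictScalars R) (C.toSubmodule ⊓ (U ⊔ maximalIdeal R • ⊤)) le_sup_left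
    (le_inf hUC le_sup_left) (sup_le le_sup_left hIm) inf_le_right with h | h
  · exact absurd (fun q hq => (h (Submodule.mem_sup_right hq)).1) hC
  · obtain ⟨_, ⟨r, rfl⟩, v, hv, rfl⟩ := Submodule.mem_sup.1
      (h ⟨hzC, Submodule.mem_sup_right (mem_smul_top_iff.2 hz)⟩)
    have hvC : v ∈ C := by simpa using sub_mem hzC (C.algebraMap_mem r)
    by_contra hnot
    apply hC
    intro w hw
    obtain ⟨r', s, h'⟩ := exists_sub_mem_of_isUniserial hU hv hw fun r' h' => hnot
      ⟨r + r', by rw [map_add, Algebra.linearMap_apply, add_sub_add_left_eq_sub]; exact h'⟩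
    simpa using add_mem (hQC _ h') (add_mem (C.algebraMap_mem r') (C.smul_mem hvC s))

theorem isFutile_of_isUniserial [Infinite (R ⧸ maximalIdeal R)]
    (h1 : IsFutile (R ⧸ maximalIdeal R) (SpecialFibre R A)) {y : basePlusNil R A}
    (hg : IsNilpotentGenerator R y)
    (hq : y ^ 2 ∉ (maximalIdeal R).map (algebraMap R (basePlusNil R A)) →
      quarticSum R (nilIdeal R A) = maximalIdeal R • (⊤ : Submodule R (basePlusNil R A)))
    (hU : IsUniserial R
      (maximalIdeal R • (⊤ : Submodule R (ModBase R A)) : Submodule R (ModBase R A))) :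
    IsFutile R A := by
  have hfin := finite_of_isFutile_specialFibre h1
  have h1' : Finite (Subalgebra R (SpecialFibre R A)) :=
    (isFutile_iff_of_surjective_algebraMap Ideal.Quotient.mk_surjective).1 h1
  let I (j : ℕ) : Ideal A := (maximalIdeal R ^ (j + 1)).map (algebraMap R A)
  have hI1 : ∀ j, I j ≤ (maximalIdeal R).map (algebraMap R A) := fun j =>
    Ideal.map_mono (Ideal.pow_le_self (Nat.succ_ne_zero _))
  have key : ∀ j, (Set.range fun B : Subalgebra R A => B.addIdeal (I j)).Finite := by
    intro j
    induction j with
    | zero =>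
      refine (Set.finite_range fun B : Subalgebra R (SpecialFibre R A) =>
        B.comap (Ideal.Quotient.mkₐ R ((maximalIdeal R).map (algebraMap R A)))).subset ?_
      rintro _ ⟨B, rfl⟩
      refine ⟨B.map (Ideal.Quotient.mkₐ R ((maximalIdeal R).map (algebraMap R A))), ?_⟩
      simp only [I, zero_add, pow_one]
      rfl
    | succ j ih =>
      -- A subalgebra containing the next power is determined by its image one level up and by
      -- whether it contains the layer `I j`.
      refine Set.Finite.of_injOn (f := fun C => (C.addIdeal (I j), ∀ q ∈ I j, q ∈ C))
        (t := (Set.range fun B : Subalgebra R A => B.addIdeal (I j)) ×ˢ (Set.univ : Set Prop))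
        (fun C _ => ⟨⟨C, rfl⟩, trivial⟩) ?_ (ih.prod Set.finite_univ)
      have hle : ∀ C D : Subalgebra R A, (∀ q ∈ I (j + 1), q ∈ C) → (∀ q ∈ I (j + 1), q ∈ D) →
          C.addIdeal (I j) = D.addIdeal (I j) → (¬ ∀ q ∈ I j, q ∈ C) → (¬ ∀ q ∈ I j, q ∈ D) →
          D ≤ C := by
        intro C D hQC hQD hCD hC hD
        have hC' := @exists_sub_mem_of_not_le _ _ _ _ _ _ _ hU j C hQC hC
        have hD' := @exists_sub_mem_of_not_le _ _ _ _ _ _ _ hU j D hQD hD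
        push Not at hC
        obtain ⟨u, hu, huC⟩ := hC
        have hQ : ∀ r : R, u - algebraMap R A r ∉ I (j + 1) := fun r hr => huC (by
          simpa using add_mem (hQC _ hr) (C.algebraMap_mem r))
        refine Subalgebra.le_of_forall_exists_sub_smul_mem hg hq (hI1 (j + 1)) hQC hQD
          (fun z hz => hD' hz) (hI1 j hu) ?_ ?_ ?_ ?_
        · intro huD
          obtain ⟨r, -, hr⟩ := hD' huD (hI1 j hu)
          exact hQ r hr
        · have := Ideal.mul_mem_mul hu hu
          rw [← Ideal.map_mul, ← pow_add] at this
          exact Ideal.map_mono (Ideal.pow_le_pow_right (by omega)) this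
        · exact fun z => exists_sub_mem_of_isUniserial hU hu (Ideal.mul_mem_left _ _ hu) hQ
        · intro d hd
          have hd' : d ∈ C.addIdeal (I j) := hCD ▸ Subalgebra.le_addIdeal hd
          obtain ⟨c, hc, hv⟩ := Subalgebra.mem_addIdeal.1 hd'
          obtain ⟨r, s, h⟩ := exists_sub_mem_of_isUniserial hU hu hv hQ
          refine ⟨s, ?_⟩
          have := add_mem (hQC _ h) (add_mem hc (C.algebraMap_mem r))
          convert this using 1
          ring
      rintro _ ⟨B, rfl⟩ _ ⟨B', rfl⟩ hBB
      obtain ⟨hadd, hiff⟩ := Prod.ext_iff.1 hBB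
      dsimp only at hadd hiff ⊢
      by_cases hB : ∀ q ∈ I j, q ∈ B.addIdeal (I (j + 1))
      · have hB' : ∀ q ∈ I j, q ∈ B'.addIdeal (I (j + 1)) := hiff ▸ hB
        rwa [Subalgebra.addIdeal_eq_self hB, Subalgebra.addIdeal_eq_self hB'] at hadd
      · have hB' : ¬ ∀ q ∈ I j, q ∈ B'.addIdeal (I (j + 1)) := hiff ▸ hB
        have hQ : ∀ B : Subalgebra R A, ∀ q ∈ I (j + 1), q ∈ B.addIdeal (I (j + 1)) :=
          fun B q hq => Subalgebra.mem_addIdeal_of_mem hq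
        exact le_antisymm (hle _ _ (hQ _) (hQ _) hadd.symm hB' hB)
          (hle _ _ (hQ _) (hQ _) hadd hB hB')
  obtain ⟨n, hn⟩ := IsArtinianRing.isNilpotent_maximalIdeal R
  have hfinite : Finite (Set.range fun B : Subalgebra R A => B.addIdeal (I n)) := key n
  refine Finite.of_injective (fun B : Subalgebra R A =>
    (⟨B.addIdeal (I n), B, rfl⟩ : Set.range fun B : Subalgebra R A => B.addIdeal (I n)))
    fun B B' h => ?_
  have hIn : I n = ⊥ := by
    simp only [I, pow_succ, hn, zero_mul]
    exact Ideal.map_bot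
  have hself : ∀ B : Subalgebra R A, B.addIdeal (I n) = B := fun B =>
    Subalgebra.addIdeal_eq_self fun q hq => by
      rw [hIn, Ideal.mem_bot] at hq
      exact hq ▸ zero_mem B
  have := congrArg Subtype.val h
  dsimp only at this
  rwa [hself, hself] at this

theorem IsFutile.specialFibre {R A : Type*} [CommRing R] [IsLocalRing R] [CommRing A]
    [Algebra R A] (h : IsFutile R A) :
    IsFutile (R ⧸ maximalIdeal R) (SpecialFibre R A) :=
  (isFutile_iff_of_surjective_algebraMap Ideal.Quotient.mk_surjective).2
    (h.of_surjective (Ideal.Quotient.mkₐ R _) Ideal.Quotient.mk_surjective)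

end Finiteness

/-! ### The equivalence. -/

theorem isFutile_iff_of_commRing (R A : Type*) [CommRing R] [IsLocalRing R] [IsArtinianRing R]
    [Infinite (R ⧸ maximalIdeal R)] [CommRing A] [Algebra R A] :
    IsFutile R A ↔
      IsFutile (R ⧸ maximalIdeal R) (SpecialFibre R A) ∧
      IsFutile (R ⧸ maximalIdeal R) (SpecialFibre R (basePlusNil R A)) ∧
      IsUniserial R
        (maximalIdeal R • (⊤ : Submodule R (ModBase R A)) : Submodule R (ModBase R A)) ∧
      (fibreNilRank R (basePlusNil R A) = 2 →
        quarticSum R (nilIdeal R A) =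
          ((maximalIdeal R).map (algebraMap R (basePlusNil R A))).restrictScalars R) := by
  constructor
  · intro h
    have hT := h.subalgebra (basePlusNil R A)
    refine ⟨h.specialFibre, hT.specialFibre, h.isUniserial_smul_modBase, fun hr => ?_⟩
    obtain ⟨y, hg⟩ := exists_isNilpotentGenerator (A := basePlusNil R A)
      exists_eq_algebraMap_add_of_mem_basePlusNil hT.specialFibre
    exact (hg.quarticSum_eq (hg.fibreNilRank_eq_two_iff.1 hr) hT
      (n := nilIdeal R A) fun z => mem_nilIdeal_iff).trans (Ideal.smul_top_eq_map _)
  · rintro ⟨h1, h2, hU, hq⟩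
    obtain ⟨y, hg⟩ := exists_isNilpotentGenerator (A := basePlusNil R A)
      exists_eq_algebraMap_add_of_mem_basePlusNil h2
    refine isFutile_of_isUniserial h1 hg (fun hy => ?_) hU
    exact (hq (hg.fibreNilRank_eq_two_iff.2 hy)).trans (Ideal.smul_top_eq_map _).symm

theorem theorem1p6 (R : Type*) [CommRing R] [IsLocalRing R] [IsArtinianRing R]
    [Infinite (R ⧸ IsLocalRing.maximalIdeal R)] (A : Type*) [hA : Ring A] [Algebra R A] :
    IsFutile R A ↔
      ∃ hcomm : ∀ a b : A, a * b = b * a,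
        letI : CommRing A := { hA with mul_comm := hcomm }
        IsFutile (R ⧸ IsLocalRing.maximalIdeal R) (SpecialFibre R A) ∧
        IsFutile (R ⧸ IsLocalRing.maximalIdeal R) (SpecialFibre R (basePlusNil R A)) ∧
        IsUniserial R
          (IsLocalRing.maximalIdeal R • (⊤ : Submodule R (ModBase R A)) :
            Submodule R (ModBase R A)) ∧
        (fibreNilRank R (basePlusNil R A) = 2 →
          quarticSum R (nilIdeal R A) =
            ((IsLocalRing.maximalIdeal R).map
              (algebraMap R (basePlusNil R A))).restrictScalars R) := by
  constructor
  · intro h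
    let _ : CommRing A := { hA with mul_comm := h.mul_comm }
    exact ⟨h.mul_comm, (isFutile_iff_of_commRing R A).1 h⟩
  · rintro ⟨hcomm, h⟩
    let _ : CommRing A := { hA with mul_comm := hcomm }
    exact (isFutile_iff_of_commRing R A).2 h
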